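/- **Setting.** Let $\mathcal S,\mathcal A$ be finite non-empty sets, $P(s'\mid s,a)$ transition probabilities, $r(s,a,s')$ rewards with $|r|\le 1$, $\gamma\in[0,1)$ a discount factor, and $\beta(a\mid s)$ a behaviour policy. Let $(s_k,a_k)_{k\ge0}$ be the Markov chain with an arbitrary initial law and transition probabilities $P(s'\mid s,a)\beta(a'\mid s')$; assume it is irreducible and aperiodic. Let $\mu_\infty(s,a)=\lim_k\mathbb P[s_k=s,a_k=a]$, $d_{\min}=\min\mu_\infty$, $d_{\max}=\max\mu_\infty$, $D_\infty=\mathrm{diag}(\mu_\infty)$. Let $m>0$ and $\rho\in(0,1)$ be constants such that, for every deterministic initial pair $(s_0,a_0)$, the law $\mu_k$ of $(s_k,a_k)$ satisfies $\max_{E\subseteq\mathcal S\times\mathcal A}|\mu_k(E)-\mu_\infty(E)|\le m\rho^k$ for all $k\ge0$. Let $R(s,a)=\sum_{s'}P(s'\mid s,a)r(s,a,s')$, let $Q^*$ be the optimal action-value function (expected discounted return, maximized over policies), let $\Pi_Q$ be the matrix of a greedy policy for $Q$, i.e. $(\Pi_QQ')(s)=Q'(s,\pi_Q(s))$ with $\pi_Q(s)\in\arg\max_aQ(s,a)$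 (ties broken by any fixed rule), and $T_Q=\gamma D_\infty P\Pi_Q-D_\infty$. Asynchronous Q-learning is $$Q_{k+1}=Q_k+\alpha_k\,\delta_k,\qquad \delta_k=e_{(s_k,a_k)}\bigl(r(s_k,a_k,s_{k+1})+\gamma\max_aQ_k(s_{k+1},a)-Q_k(s_k,a_k)\bigr),$$ and $w_k=\delta_k-(D_\infty R+\gamma D_\infty P\Pi_{Q_k}Q_k-D_\infty Q_k)$. The lower and upper comparison systems are $$Q^L_{k+1}-Q^*=(I+\alpha_kT_{Q^*})(Q^L_k-Q^*)+\alpha_kw_k,\qquad Q^U_{k+1}-Q^*=(I+\alpha_kT_{Q_k})(Q^U_k-Q^*)+\alpha_kw_k,$$ with deterministic $Q^L_0\le Q_0\le Q^U_0$ (entrywise), all three of sup-norm at most $1$. The step-size is $\alpha_k=\theta/(k+\xi)$. Let $G\succ0$ solve $T_{Q^*}^{\top}G+GT_{Q^*}=-I$ and $B=G^{1/2}T_{Q^*}G^{-1/2}$. For a constant $c$, the parameters satisfy $\frac{2}{(1-\gamma)d_{\min}}\le\theta\le\xi$ and $$\theta\le c\max\Bigl\{\lambda_{\max}(G),\tfrac{|\mathcal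 S||\mathcal A|}{(1-\gamma)d_{\min}}\Bigr\},\qquad \xi\le c\max\Bigl\{\theta^2\|B\|_2^2,\tfrac{(|\mathcal S||\mathcal A|)^{8}d_{\max}^{3}}{(1-\gamma)^{3}d_{\min}^{3}}\Bigr\}.$$ Put $\tau^{\mathrm{mix}}(x)=\min\{k\in\mathbb N: m\rho^k\le x\}$ and $K_{\mathrm{mix}}=\min\{k: t\ge2\tau^{\mathrm{mix}}(\alpha_t)\ \text{for all } t\ge k\}$. **Theorem.** For every $c$ there is a constant $C>0$, depending on nothing but $c$, such that in the above setting, for every $k\ge K_{\mathrm{mix}}$, $\|Q^U_k-Q^L_k\|_\infty$ is integrable and $$\mathbb E\bigl[\|Q^U_k-Q^L_k\|_\infty\bigr]\le\frac{C^U}{\sqrt{k+\xi}}+\frac{C(|\mathcal S||\mathcal A|)^{31/8}d_{\max}}{(1-\gamma)^{7/2}d_{\min}^{5/2}}\,\frac{\sqrt{\tau^{\mathrm{mix}}(\alpha_k)}}{\sqrt{k+\xi}},$$ $$C^U=C\max\Bigl\{\frac{(|\mathcal S||\mathcal A|)^4d_{\max}^{5/2}}{(1-\gamma)^{5/2}d_{\min}^{5/2}}\|Q^L_0-Q^*\|_2,\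 \frac{(|\mathcal S||\mathcal A|)^{15/4}}{(1-\gamma)^4d_{\min}^3}\Bigr\}.$$ -/

import Mathlib

open Filter Topology MeasureTheory Matrix
open scoped MatrixOrder

universe u v w

noncomputable section

namespace QLearning

/-- A finite discounted Markov decision process with transition probabilities `P (s, a) s'`, rewards
`r (s, a) s'` and discount factor `γ`, together with a behaviour policy `b s a`. -/
structure Model (S : Type u) (A : Type v) [Fintype S] [Fintype A] where
  P : Matrix (S × A) S ℝ
  P_nonneg : ∀ x s', 0 ≤ P x s'
  P_sum : ∀ x, ∑ s', P x s' = 1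
  r : S × A → S → ℝ
  r_bound : ∀ x s', |r x s'| ≤ 1
  γ : ℝ
  γ_nonneg : 0 ≤ γ
  γ_lt_one : γ < 1
  b : S → A → ℝ
  b_nonneg : ∀ s a, 0 ≤ b s a
  b_sum : ∀ s, ∑ a, b s a = 1

/-- The selection matrix `Π` of a deterministic policy: `(Π Q)(s) = Q (s, π s)`. -/
def policyMatrix {S : Type u} {A : Type v} [DecidableEq S] [DecidableEq A] (π : S → A) :
    Matrix S (S × A) ℝ :=
  fun s x => if x = (s, π s) then 1 else 0

/-- A greedy policy selector, with an arbitrary rule for breaking ties. -/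
def IsGreedy {S : Type u} {A : Type v} (g : (S × A → ℝ) → S → A) : Prop :=
  ∀ (Q : S × A → ℝ) (s : S) (a : A), Q (s, a) ≤ Q (s, g Q s)

/-- Total variation distance of two probability vectors on a finite set. -/
def tvDist {X : Type w} [Fintype X] (p q : X → ℝ) : ℝ :=
  ⨆ E : Finset X, |∑ x ∈ E, p x - ∑ x ∈ E, q x|

/-- The Euclidean norm of a vector. -/
def norm2 {X : Type w} [Fintype X] (x : X → ℝ) : ℝ := ‖WithLp.toLp 2 x‖

/-- The spectral norm (operator norm for the Euclidean norm) of a square matrix. -/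
def opNorm2 {X : Type w} [Fintype X] [DecidableEq X] (M : Matrix X X ℝ) : ℝ :=
  ‖Matrix.toEuclideanCLM (n := X) (𝕜 := ℝ) M‖

/-- For every index the greatest common divisor of its return times is one. -/
def Aperiodic {X : Type w} [Fintype X] [DecidableEq X] (M : Matrix X X ℝ) : Prop :=
  ∀ x, ∀ d : ℕ, (∀ n : ℕ, 1 ≤ n → 0 < (M ^ n) x x → d ∣ n) → d = 1

/-- The step-size `α_k = θ / (k + ξ)`. -/
def stepSize (θ ξ : ℝ) (k : ℕ) : ℝ := θ / ((k : ℝ) + ξ)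

/-- `τ^mix(c) = min {k | m ρ ^ k ≤ c}`. -/
def tauMix (m ρ c : ℝ) : ℕ := sInf {k : ℕ | m * ρ ^ k ≤ c}

/-- `K_mix = min {k | t ≥ 2 τ^mix(α_t) for all t ≥ k}`. -/
def KMix (m ρ : ℝ) (α : ℕ → ℝ) : ℕ :=
  sInf {k : ℕ | ∀ t : ℕ, k ≤ t → 2 * tauMix m ρ (α t) ≤ t}

namespace Model

variable {S : Type u} {A : Type v} [Fintype S] [Fintype A] [DecidableEq S] [DecidableEq A]

/-- Expected one-step reward. -/
def R (𝓜 : Model S A) : S × A → ℝ := fun x => ∑ s', 𝓜.P x s' * 𝓜.r x s'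

/-- Transition matrix of the state-action chain under the behaviour policy. -/
def chain (𝓜 : Model S A) : Matrix (S × A) (S × A) ℝ :=
  fun x y => 𝓜.P x y.1 * 𝓜.b y.1 y.2

/-- The action-value function of a policy, `Q^π(x) = ∑ γ^t E[r_t | (s_0, a_0) = x, π]`. -/
def QPolicy (𝓜 : Model S A) (π : S → A) : S × A → ℝ :=
  fun x => ∑' t : ℕ, 𝓜.γ ^ t * (((𝓜.P * policyMatrix π) ^ t) *ᵥ 𝓜.R) x

/-- The optimal action-value function `Q^*`. -/
def QStar (𝓜 : Model S A) : S × A → ℝ := fun x => ⨆ π : S → A, 𝓜.QPolicy π x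

/-- The law `μ_k` of `(s_k, a_k)` when `(s_0, a_0)` has law `μ₀`. -/
def law (𝓜 : Model S A) (μ₀ : S × A → ℝ) (k : ℕ) : S × A → ℝ := μ₀ ᵥ* (𝓜.chain ^ k)

/-- The limiting state-action distribution `μ_∞(x) = lim_k μ_k(x)`. -/
def muInf (𝓜 : Model S A) (μ₀ : S × A → ℝ) : S × A → ℝ :=
  fun x => limUnder atTop (fun k => 𝓜.law μ₀ k x)

/-- Smallest stationary state-action probability. -/
def dMin (𝓜 : Model S A) (μ₀ : S × A → ℝ) : ℝ := ⨅ x, 𝓜.muInf μ₀ x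

/-- Largest stationary state-action probability. -/
def dMax (𝓜 : Model S A) (μ₀ : S × A → ℝ) : ℝ := ⨆ x, 𝓜.muInf μ₀ x

/-- Geometric mixing of the state-action chain with constants `m` and `ρ`, whatever its initial
state-action pair. -/
def MixesWith (𝓜 : Model S A) (μ₀ : S × A → ℝ) (m ρ : ℝ) : Prop :=
  ∀ (x : S × A) (k : ℕ), tvDist (𝓜.law (Pi.single x 1) k) (𝓜.muInf μ₀) ≤ m * ρ ^ k

/-- `D_∞`. -/
def D (𝓜 : Model S A) (μ₀ : S × A → ℝ) : Matrix (S × A) (S × A) ℝ :=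
  Matrix.diagonal (𝓜.muInf μ₀)

/-- `T = γ D_∞ P Π - D_∞` for the policy `π`. -/
def T (𝓜 : Model S A) (μ₀ : S × A → ℝ) (π : S → A) : Matrix (S × A) (S × A) ℝ :=
  𝓜.γ • (𝓜.D μ₀ * 𝓜.P * policyMatrix π) - 𝓜.D μ₀

/-- The temporal-difference direction observed when the transition `x → s'` is seen:
`e_x (r(x, s') + γ max_a Q(s', a) - Q(x))`. -/
def td (𝓜 : Model S A) (Q : S × A → ℝ) (x : S × A) (s' : S) : S × A → ℝ :=
  Pi.single x (𝓜.r x s' + 𝓜.γ * (⨆ a, Q (s', a)) - Q x)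

/-- The noise `w`: the observed direction minus its stationary mean
`D_∞ R + γ D_∞ P Π_Q Q - D_∞ Q`. -/
def noise (𝓜 : Model S A) (μ₀ : S × A → ℝ) (g : (S × A → ℝ) → S → A)
    (Q : S × A → ℝ) (x : S × A) (s' : S) : S × A → ℝ :=
  𝓜.td Q x s' - (𝓜.D μ₀ *ᵥ 𝓜.R + 𝓜.T μ₀ (g Q) *ᵥ Q)

/-- Asynchronous Q-learning along the state-action path `z`. -/
def Qiter (𝓜 : Model S A) (α : ℕ → ℝ) (Q₀ : S × A → ℝ) (z : ℕ → S × A) : ℕ → S × A → ℝ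
  | 0 => Q₀
  | k + 1 => 𝓜.Qiter α Q₀ z k + α k • 𝓜.td (𝓜.Qiter α Q₀ z k) (z k) (z (k + 1)).1

/-- The noise `w_k` along the path. -/
def noiseAt (𝓜 : Model S A) (μ₀ : S × A → ℝ) (g : (S × A → ℝ) → S → A) (α : ℕ → ℝ)
    (Q₀ : S × A → ℝ) (z : ℕ → S × A) (k : ℕ) : S × A → ℝ :=
  𝓜.noise μ₀ g (𝓜.Qiter α Q₀ z k) (z k) (z (k + 1)).1

/-- The lower comparison system
`Q^L_{k+1} - Q^* = (I + α_k T_{Q^*}) (Q^L_k - Q^*) + α_k w_k`. -/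
def QLower (𝓜 : Model S A) (μ₀ : S × A → ℝ) (g : (S × A → ℝ) → S → A) (α : ℕ → ℝ)
    (Q₀ QL₀ : S × A → ℝ) (z : ℕ → S × A) : ℕ → S × A → ℝ
  | 0 => QL₀
  | k + 1 => 𝓜.QStar
      + (1 + α k • 𝓜.T μ₀ (g 𝓜.QStar)) *ᵥ (𝓜.QLower μ₀ g α Q₀ QL₀ z k - 𝓜.QStar)
      + α k • 𝓜.noiseAt μ₀ g α Q₀ z k

/-- The upper comparison system
`Q^U_{k+1} - Q^* = (I + α_k T_{Q_k}) (Q^U_k - Q^*) + α_k w_k`. -/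
def QUpper (𝓜 : Model S A) (μ₀ : S × A → ℝ) (g : (S × A → ℝ) → S → A) (α : ℕ → ℝ)
    (Q₀ QU₀ : S × A → ℝ) (z : ℕ → S × A) : ℕ → S × A → ℝ
  | 0 => QU₀
  | k + 1 => 𝓜.QStar
      + (1 + α k • 𝓜.T μ₀ (g (𝓜.Qiter α Q₀ z k))) *ᵥ
          (𝓜.QUpper μ₀ g α Q₀ QU₀ z k - 𝓜.QStar)
      + α k • 𝓜.noiseAt μ₀ g α Q₀ z k

/-- `Z` is the Markov chain of state-action pairs `(s_k, a_k)` with initial law `μ₀`, given by its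
finite-dimensional distributions. -/
structure IsTrajectory (𝓜 : Model S A) (μ₀ : S × A → ℝ) {Ω : Type w} [MeasurableSpace Ω]
    (ℙ : Measure Ω) (Z : ℕ → Ω → S × A) : Prop where
  measurable : ∀ k x, MeasurableSet {ω | Z k ω = x}
  law_eq : ∀ (n : ℕ) (z : ℕ → S × A),
    ℙ {ω | ∀ i, i ≤ n → Z i ω = z i} =
      ENNReal.ofReal (μ₀ (z 0) * ∏ i ∈ Finset.range n, 𝓜.chain (z i) (z (i + 1)))

/-- `G` is the positive definite solution of the Lyapunov equation `Tᵀ G + G T = -I`. -/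
def IsLyapunov {X : Type w} [Fintype X] [DecidableEq X] (T G : Matrix X X ℝ) : Prop :=
  G.PosDef ∧ Tᵀ * G + G * T = -1

/-- `B = G^{1/2} T G^{-1/2}`. -/
def similar {X : Type w} [Fintype X] [DecidableEq X] (T G : Matrix X X ℝ) : Matrix X X ℝ :=
  CFC.sqrt G * T * (CFC.sqrt G)⁻¹

/-- The parameters of the diminishing step-size `θ / (k + ξ)`. The lower bounds give
`1 - (1 - γ) d_min α_k ≤ 1 - 2 / (k + ξ)` and `α_k ≤ 1`. The upper bounds say that `θ` and `ξ` are
not larger, up to the factor `c`, than the Lyapunov analysis asks for; `opNorm2 G` is the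
largest eigenvalue of `G`. -/
structure IsStepParam (𝓜 : Model S A) (μ₀ : S × A → ℝ) (g : (S × A → ℝ) → S → A)
    (c θ ξ : ℝ) : Prop where
  θ_lower : 2 / ((1 - 𝓜.γ) * 𝓜.dMin μ₀) ≤ θ
  ξ_lower : θ ≤ ξ
  upper : ∃ G : Matrix (S × A) (S × A) ℝ, IsLyapunov (𝓜.T μ₀ (g 𝓜.QStar)) G ∧
    θ ≤ c * max (opNorm2 G)
      ((Fintype.card S * Fintype.card A : ℝ) / ((1 - 𝓜.γ) * 𝓜.dMin μ₀)) ∧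
    ξ ≤ c * max (θ ^ 2 * opNorm2 (similar (𝓜.T μ₀ (g 𝓜.QStar)) G) ^ 2)
      ((Fintype.card S * Fintype.card A : ℝ) ^ 8 * 𝓜.dMax μ₀ ^ 3
        / ((1 - 𝓜.γ) * 𝓜.dMin μ₀) ^ 3)

end Model

end QLearning

end

/-! ### Total variation and the stationary law -/

namespace QLearning

/-! The noise `w_k` enters both comparison systems identically, so it cancels in the gap `D_k =
Q^U_k - Q^L_k`, which obeys `D_{k+1} = (I + α_k T_{Q_k}) D_k + α_k (T_{Q_k} - T_{Q^*}) (Q^L_k -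
Q^*)`. For `0 ≤ a ≤ 1` the matrix `I + a T` has nonnegative entries and row sums at most `1 - κ a`,
with `κ = (1 - γ) d_min`, whatever the policy; hence it contracts the sup-norm
(`sum_abs_one_add_smul_T_le`). Since `κ θ ≥ 2`, such a recursion answers a forcing of order `1 / √(k
+ ξ)` by a solution of the same order (`sqrt_recursion_step`). It remains to bound the mean of
`‖Q^L_k - Q^*‖`.

That system is linear and driven by the noise. Its transient decays like `√ξ / √(k + ξ)`; the rest
is the response `N_k` to the noise (`noiseSum`). The second moments of the coordinates of `N_k`
contract at rate `κ α_k`, with the correlations `E[N_k(y) w_k(x)]` as source. These do not vanish,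
because the noise is Markovian. Going back `l` steps, `l` a mixing time, costs `O(l α)` in `N` and
in `Q`; the noise with `Q` frozen there has a small conditional mean, because its stationary mean is
zero. This gives `E[N_k(x)^2] = O(l / (k + ξ))` (`integral_noiseSum_sq_le`).

The Lyapunov matrix plays no part in these estimates. It only turns the upper bounds on `θ` and `ξ`
into explicit ones: `I + T` being a contraction gives `‖G‖ ≤ |S||A| / κ`, and `‖B‖² ≤ 2 ‖G‖ ‖T‖³`
(`theta_le`, `xi_le`). What is left is a comparison of monomials (`constant_le`). -/

/-- An event has measure difference at most the total variation distance. -/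
lemma abs_sum_sub_sum_le_tvDist {X : Type w} [Fintype X] (p q : X → ℝ) (E : Finset X) :
    |∑ x ∈ E, p x - ∑ x ∈ E, q x| ≤ tvDist p q :=
  le_ciSup (f := fun E : Finset X => |∑ x ∈ E, p x - ∑ x ∈ E, q x|)
    (Set.finite_range _).bddAbove E

lemma abs_sub_le_tvDist {X : Type w} [Fintype X] (p q : X → ℝ) (x : X) :
    |p x - q x| ≤ tvDist p q := by
  simpa using abs_sum_sub_sum_le_tvDist p q {x}

/-- The `ℓ¹` distance is at most twice the total variation distance. -/
lemma sum_abs_sub_le_two_mul_tvDist {X : Type w} [Fintype X] (p q : X → ℝ) :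
    ∑ x, |p x - q x| ≤ 2 * tvDist p q := by
  classical
  rw [← Finset.sum_filter_add_sum_filter_not Finset.univ (fun x => 0 ≤ p x - q x)]
  have h1 := abs_sum_sub_sum_le_tvDist p q (Finset.univ.filter fun x => 0 ≤ p x - q x)
  have h2 := abs_sum_sub_sum_le_tvDist p q (Finset.univ.filter fun x => ¬ 0 ≤ p x - q x)
  rw [← Finset.sum_sub_distrib] at h1 h2
  have e1 : ∑ x ∈ Finset.univ.filter (fun x => 0 ≤ p x - q x), |p x - q x|
      = ∑ x ∈ Finset.univ.filter (fun x => 0 ≤ p x - q x), (p x - q x) :=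
    Finset.sum_congr rfl fun x hx => abs_of_nonneg (Finset.mem_filter.1 hx).2
  have e2 : ∑ x ∈ Finset.univ.filter (fun x => ¬ 0 ≤ p x - q x), |p x - q x|
      = - ∑ x ∈ Finset.univ.filter (fun x => ¬ 0 ≤ p x - q x), (p x - q x) := by
    rw [← Finset.sum_neg_distrib]
    exact Finset.sum_congr rfl fun x hx => abs_of_neg (not_le.1 (Finset.mem_filter.1 hx).2)
  rw [e1, e2]
  linarith [le_abs_self (∑ x ∈ Finset.univ.filter (fun x => 0 ≤ p x - q x), (p x - q x)),
    neg_le_abs (∑ x ∈ Finset.univ.filter (fun x => ¬ 0 ≤ p x - q x), (p x - q x))]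

namespace Model

variable {S : Type u} {A : Type v} [Fintype S] [Fintype A]

lemma chain_nonneg (𝓜 : Model S A) (x y : S × A) : 0 ≤ 𝓜.chain x y :=
  mul_nonneg (𝓜.P_nonneg _ _) (𝓜.b_nonneg _ _)

/-- Averaging a function of the next state over the state-action chain. -/
lemma sum_chain_mul (𝓜 : Model S A) (x : S × A) (f : S → ℝ) :
    ∑ y, 𝓜.chain x y * f y.1 = ∑ s', 𝓜.P x s' * f s' := by
  rw [Fintype.sum_prod_type]
  refine Finset.sum_congr rfl fun s' _ => ?_
  simp only [chain]
  rw [← mul_one (𝓜.P x s' * f s'), ← 𝓜.b_sum s', Finset.mul_sum]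
  exact Finset.sum_congr rfl fun a _ => by ring

lemma chain_sum (𝓜 : Model S A) (x : S × A) : ∑ y, 𝓜.chain x y = 1 := by
  simpa [𝓜.P_sum] using 𝓜.sum_chain_mul x (fun _ => 1)

variable [DecidableEq S] [DecidableEq A]

lemma chain_pow_nonneg (𝓜 : Model S A) (k : ℕ) (x y : S × A) : 0 ≤ (𝓜.chain ^ k) x y := by
  induction k generalizing y with
  | zero => rw [pow_zero, Matrix.one_apply]; split_ifs <;> norm_num
  | succ k ih =>
    rw [pow_succ, Matrix.mul_apply]
    exact Finset.sum_nonneg fun z _ => mul_nonneg (ih z) (𝓜.chain_nonneg z y)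

lemma chain_pow_sum (𝓜 : Model S A) (k : ℕ) (x : S × A) : ∑ y, (𝓜.chain ^ k) x y = 1 := by
  induction k with
  | zero => simp [Matrix.one_apply]
  | succ k ih =>
    simp only [pow_succ, Matrix.mul_apply]
    rw [Finset.sum_comm]
    simp [← Finset.mul_sum, 𝓜.chain_sum, ih]

lemma law_single (𝓜 : Model S A) (x : S × A) (k : ℕ) :
    𝓜.law (Pi.single x 1) k = (𝓜.chain ^ k) x := by
  ext y
  simp [law]

section Stationary

variable {𝓜 : Model S A} {μ₀ : S × A → ℝ} {m ρ : ℝ}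

lemma MixesWith.sum_abs_le (hmix : 𝓜.MixesWith μ₀ m ρ) (x : S × A) (k : ℕ) :
    ∑ y, |(𝓜.chain ^ k) x y - 𝓜.muInf μ₀ y| ≤ 2 * (m * ρ ^ k) := by
  have h := hmix x k
  rw [law_single] at h
  exact (sum_abs_sub_le_two_mul_tvDist _ _).trans (by linarith)

/-- Mixing identifies `muInf` as the limit from every deterministic start. All properties of `muInf`
are drawn from this, so its definition through `limUnder` is never unfolded. -/
lemma MixesWith.tendsto (hmix : 𝓜.MixesWith μ₀ m ρ) (hρ : 0 < ρ) (hρ' : ρ < 1) (x y : S × A) :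
    Tendsto (fun k => (𝓜.chain ^ k) x y) atTop (𝓝 (𝓜.muInf μ₀ y)) := by
  have h0 : Tendsto (fun k : ℕ => m * ρ ^ k) atTop (𝓝 0) := by
    simpa using (tendsto_pow_atTop_nhds_zero_of_lt_one hρ.le hρ').const_mul m
  rw [tendsto_iff_dist_tendsto_zero]
  refine squeeze_zero (fun _ => dist_nonneg) (fun k => ?_) h0
  have h := hmix x k
  rw [law_single] at h
  rw [Real.dist_eq]
  exact (abs_sub_le_tvDist _ _ y).trans h

lemma MixesWith.muInf_nonneg (hmix : 𝓜.MixesWith μ₀ m ρ) (hρ : 0 < ρ) (hρ' : ρ < 1)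
    (y : S × A) : 0 ≤ 𝓜.muInf μ₀ y :=
  ge_of_tendsto' (hmix.tendsto hρ hρ' y y) fun k => 𝓜.chain_pow_nonneg k y y

lemma MixesWith.muInf_sum [Nonempty S] [Nonempty A] (hmix : 𝓜.MixesWith μ₀ m ρ) (hρ : 0 < ρ)
    (hρ' : ρ < 1) : ∑ y, 𝓜.muInf μ₀ y = 1 := by
  obtain ⟨x⟩ : Nonempty (S × A) := inferInstance
  have h := tendsto_finsetSum Finset.univ fun y (_ : y ∈ Finset.univ) => hmix.tendsto hρ hρ' x y
  simp only [𝓜.chain_pow_sum] at h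
  exact (tendsto_nhds_unique h tendsto_const_nhds)

/-- Let `k → ∞` in `chain ^ (k + j) = chain ^ k * chain ^ j`. -/
lemma MixesWith.muInf_stationary (hmix : 𝓜.MixesWith μ₀ m ρ) (hρ : 0 < ρ)
    (hρ' : ρ < 1) (j : ℕ) (y : S × A) :
    ∑ x, 𝓜.muInf μ₀ x * (𝓜.chain ^ j) x y = 𝓜.muInf μ₀ y := by
  have h := tendsto_finsetSum Finset.univ fun x (_ : x ∈ Finset.univ) =>
    (hmix.tendsto hρ hρ' y x).mul_const ((𝓜.chain ^ j) x y)
  refine tendsto_nhds_unique h ?_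
  refine ((tendsto_add_atTop_iff_nat j).2 (hmix.tendsto hρ hρ' y y)).congr fun k => ?_
  rw [pow_add, Matrix.mul_apply]

/-- The stationary law of an irreducible chain charges every state-action pair. -/
lemma MixesWith.muInf_pos [Nonempty S] [Nonempty A] (hmix : 𝓜.MixesWith μ₀ m ρ) (hρ : 0 < ρ)
    (hρ' : ρ < 1) (hirr : 𝓜.chain.IsIrreducible) (y : S × A) : 0 < 𝓜.muInf μ₀ y := by
  have hnn := hmix.muInf_nonneg hρ hρ'
  obtain ⟨x, hx⟩ : ∃ x, 0 < 𝓜.muInf μ₀ x := by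
    by_contra! h
    have := hmix.muInf_sum hρ hρ'
    rw [Finset.sum_eq_zero fun x _ => le_antisymm (h x) (hnn x)] at this
    norm_num at this
  obtain ⟨j, -, hj⟩ := (Matrix.isIrreducible_iff_exists_pow_pos 𝓜.chain_nonneg).1 hirr x y
  rw [← hmix.muInf_stationary hρ hρ' j y]
  exact (mul_pos hx hj).trans_le
    (Finset.single_le_sum (f := fun x => 𝓜.muInf μ₀ x * (𝓜.chain ^ j) x y)
      (fun z _ => mul_nonneg (hnn z) (𝓜.chain_pow_nonneg j z y)) (Finset.mem_univ x))

end Stationary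

lemma dMin_le (𝓜 : Model S A) (μ₀ : S × A → ℝ) (x : S × A) : 𝓜.dMin μ₀ ≤ 𝓜.muInf μ₀ x :=
  ciInf_le (Set.finite_range _).bddBelow x

lemma le_dMax (𝓜 : Model S A) (μ₀ : S × A → ℝ) (x : S × A) : 𝓜.muInf μ₀ x ≤ 𝓜.dMax μ₀ :=
  le_ciSup (Set.finite_range _).bddAbove x

/-- The stationary law is a probability vector with positive entries. -/
structure PosStationary (𝓜 : Model S A) (μ₀ : S × A → ℝ) : Prop where
  pos : ∀ x, 0 < 𝓜.muInf μ₀ x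
  sum : ∑ x, 𝓜.muInf μ₀ x = 1

namespace PosStationary

variable {𝓜 : Model S A} {μ₀ : S × A → ℝ}

lemma le_one (h : 𝓜.PosStationary μ₀) (x : S × A) : 𝓜.muInf μ₀ x ≤ 1 := by
  rw [← h.sum]
  exact Finset.single_le_sum (fun y _ => (h.pos y).le) (Finset.mem_univ x)

/-- Lets the final comparison of constants trade powers of `|S||A|` for powers of `d_min`. -/
lemma card_mul_dMin_le (h : 𝓜.PosStationary μ₀) :
    (Fintype.card S * Fintype.card A : ℝ) * 𝓜.dMin μ₀ ≤ 1 := by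
  rw [← h.sum]
  have := Finset.card_nsmul_le_sum Finset.univ (𝓜.muInf μ₀) (𝓜.dMin μ₀)
    fun x _ => 𝓜.dMin_le μ₀ x
  simpa [Fintype.card_prod] using this

variable [Nonempty S] [Nonempty A]

lemma dMin_pos (h : 𝓜.PosStationary μ₀) : 0 < 𝓜.dMin μ₀ := by
  obtain ⟨x, hx⟩ := exists_eq_ciInf_of_finite (f := 𝓜.muInf μ₀)
  rw [dMin, ← hx]
  exact h.pos x

lemma dMax_le_one (h : 𝓜.PosStationary μ₀) : 𝓜.dMax μ₀ ≤ 1 := ciSup_le h.le_one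

lemma dMin_le_dMax (_h : 𝓜.PosStationary μ₀) : 𝓜.dMin μ₀ ≤ 𝓜.dMax μ₀ := by
  obtain ⟨x⟩ : Nonempty (S × A) := inferInstance
  exact (𝓜.dMin_le μ₀ x).trans (𝓜.le_dMax μ₀ x)

end PosStationary

end Model

end QLearning

/-! ### Sup-norm estimates for `T` and the contraction `I + a T` -/

namespace QLearning

namespace Model

variable {S : Type u} {A : Type v} [Fintype S] [Fintype A]

lemma abs_sum_P_mul_le (𝓜 : Model S A) (x : S × A) (f : S → ℝ) {B : ℝ} (hf : ∀ s', |f s'| ≤ B) :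
    |∑ s', 𝓜.P x s' * f s'| ≤ B := by
  calc |∑ s', 𝓜.P x s' * f s'| ≤ ∑ s', |𝓜.P x s' * f s'| := Finset.abs_sum_le_sum_abs _ _
    _ ≤ ∑ s', 𝓜.P x s' * B := Finset.sum_le_sum fun s' _ => by
        rw [abs_mul, abs_of_nonneg (𝓜.P_nonneg x s')]
        exact mul_le_mul_of_nonneg_left (hf s') (𝓜.P_nonneg x s')
    _ = B := by rw [← Finset.sum_mul, 𝓜.P_sum, one_mul]

variable [DecidableEq S] [DecidableEq A]

lemma policyMatrix_mulVec (π : S → A) (v : S × A → ℝ) (s : S) :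
    (policyMatrix π *ᵥ v) s = v (s, π s) := by
  simp [Matrix.mulVec, dotProduct, policyMatrix]

lemma T_mulVec (𝓜 : Model S A) (μ₀ : S × A → ℝ) (π : S → A) (v : S × A → ℝ) (x : S × A) :
    (𝓜.T μ₀ π *ᵥ v) x
      = 𝓜.muInf μ₀ x * (𝓜.γ * ∑ s', 𝓜.P x s' * v (s', π s') - v x) := by
  have h : (𝓜.P *ᵥ (policyMatrix π *ᵥ v)) x = ∑ s', 𝓜.P x s' * v (s', π s') :=
    Finset.sum_congr rfl fun s' _ => by rw [policyMatrix_mulVec]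
  rw [T, Matrix.sub_mulVec, Matrix.smul_mulVec, Matrix.mul_assoc, ← Matrix.mulVec_mulVec,
    ← Matrix.mulVec_mulVec, Pi.sub_apply, Pi.smul_apply, D, Matrix.mulVec_diagonal,
    Matrix.mulVec_diagonal, h, smul_eq_mul]
  ring

lemma abs_apply_le_norm {X : Type w} [Fintype X] (v : X → ℝ) (x : X) : |v x| ≤ ‖v‖ :=
  norm_le_pi_norm v x

section

variable {𝓜 : Model S A} {μ₀ : S × A → ℝ}

lemma PosStationary.dMax_nonneg [Nonempty S] [Nonempty A] (h : 𝓜.PosStationary μ₀) :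
    0 ≤ 𝓜.dMax μ₀ := h.dMin_pos.le.trans h.dMin_le_dMax

lemma PosStationary.norm_T_mulVec_le [Nonempty S] [Nonempty A] (h : 𝓜.PosStationary μ₀)
    (π : S → A) (v : S × A → ℝ) : ‖𝓜.T μ₀ π *ᵥ v‖ ≤ 2 * 𝓜.dMax μ₀ * ‖v‖ := by
  have hd := h.dMax_nonneg
  refine (pi_norm_le_iff_of_nonneg (by positivity)).2 fun x => ?_
  rw [T_mulVec, Real.norm_eq_abs, abs_mul, abs_of_pos (h.pos x)]
  have h1 := 𝓜.abs_sum_P_mul_le x (fun s' => v (s', π s')) fun s' => abs_apply_le_norm v _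
  have h2 : |𝓜.γ * ∑ s', 𝓜.P x s' * v (s', π s') - v x| ≤ 2 * ‖v‖ := by
    calc _ ≤ |𝓜.γ * ∑ s', 𝓜.P x s' * v (s', π s')| + |v x| := abs_sub _ _
      _ ≤ 1 * ‖v‖ + ‖v‖ := by
        rw [abs_mul, abs_of_nonneg 𝓜.γ_nonneg]
        gcongr
        · exact 𝓜.γ_lt_one.le
        · exact abs_apply_le_norm v x
      _ = 2 * ‖v‖ := by ring
  calc _ ≤ 𝓜.dMax μ₀ * (2 * ‖v‖) := mul_le_mul (𝓜.le_dMax μ₀ x) h2 (abs_nonneg _) hd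
    _ = _ := by ring

/-- The diagonal parts cancel, and what remains compares `v` at two actions of the same state. No
closeness of the policies is needed; this bounds the forcing in the gap recursion. -/
lemma PosStationary.norm_T_sub_T_mulVec_le [Nonempty S] [Nonempty A] (h : 𝓜.PosStationary μ₀)
    (π π' : S → A) (v : S × A → ℝ) :
    ‖𝓜.T μ₀ π *ᵥ v - 𝓜.T μ₀ π' *ᵥ v‖ ≤ 2 * 𝓜.dMax μ₀ * ‖v‖ := by
  have hd := h.dMax_nonneg
  refine (pi_norm_le_iff_of_nonneg (by positivity)).2 fun x => ?_
  have e : (𝓜.T μ₀ π *ᵥ v - 𝓜.T μ₀ π' *ᵥ v) x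
      = 𝓜.muInf μ₀ x * (𝓜.γ * ∑ s', 𝓜.P x s' * (v (s', π s') - v (s', π' s'))) := by
    rw [Pi.sub_apply, T_mulVec, T_mulVec]
    simp only [mul_sub, Finset.sum_sub_distrib]
    ring
  have h1 := 𝓜.abs_sum_P_mul_le x (fun s' => v (s', π s') - v (s', π' s')) (B := 2 * ‖v‖)
    fun s' => by
      refine (abs_sub _ _).trans ?_
      linarith [abs_apply_le_norm v (s', π s'), abs_apply_le_norm v (s', π' s')]
  rw [e, Real.norm_eq_abs, abs_mul, abs_mul, abs_of_pos (h.pos x), abs_of_nonneg 𝓜.γ_nonneg]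
  calc _ ≤ 𝓜.dMax μ₀ * (1 * (2 * ‖v‖)) := by
        refine mul_le_mul (𝓜.le_dMax μ₀ x) ?_ (by have := 𝓜.γ_nonneg; positivity) hd
        exact mul_le_mul 𝓜.γ_lt_one.le h1 (abs_nonneg _) zero_le_one
    _ = _ := by ring

/-- The rows of `I + a T` have `ℓ¹` norm at most `1 - (1 - γ) d_min a`. -/
lemma PosStationary.sum_abs_one_add_smul_T_le (h : 𝓜.PosStationary μ₀) (π : S → A) {a : ℝ}
    (ha : 0 ≤ a) (ha' : a ≤ 1) (x : S × A) :
    ∑ y, |(1 + a • 𝓜.T μ₀ π) x y| ≤ 1 - (1 - 𝓜.γ) * 𝓜.dMin μ₀ * a := by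
  have hp := h.pos x
  have hγ := 𝓜.γ_nonneg
  have hle : a * 𝓜.muInf μ₀ x ≤ 1 := mul_le_one₀ ha' hp.le (h.le_one x)
  -- Each row is `1 - a μ` times a unit row plus `a μ γ` times a stochastic row. Both weights are
  -- nonnegative because `a μ ≤ 1`, so absolute values can be dropped and the row sums to `1 - (1 -
  -- γ) μ a`.
  have e : ∀ y, (1 + a • 𝓜.T μ₀ π) x y = (1 - a * 𝓜.muInf μ₀ x) * (if x = y then 1 else 0)
      + a * 𝓜.muInf μ₀ x * 𝓜.γ * (𝓜.P * policyMatrix π) x y := by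
    intro y
    have : (𝓜.D μ₀ * 𝓜.P * policyMatrix π) x y
        = 𝓜.muInf μ₀ x * (𝓜.P * policyMatrix π) x y := by
      rw [Matrix.mul_assoc, D, Matrix.diagonal_mul]
    rw [Matrix.add_apply, Matrix.smul_apply, T, Matrix.sub_apply, Matrix.smul_apply, this,
      Matrix.one_apply, D, Matrix.diagonal_apply]
    split_ifs <;> simp only [smul_eq_mul] <;> ring
  have hPP : ∀ y, 0 ≤ (𝓜.P * policyMatrix π) x y := fun y => by
    rw [Matrix.mul_apply]
    refine Finset.sum_nonneg fun s' _ => mul_nonneg (𝓜.P_nonneg _ _) ?_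
    rw [policyMatrix]; split_ifs <;> norm_num
  have hPs : ∑ y, (𝓜.P * policyMatrix π) x y = 1 := by
    simp only [Matrix.mul_apply]
    rw [Finset.sum_comm, ← 𝓜.P_sum x]
    exact Finset.sum_congr rfl fun s' _ => by simp [policyMatrix]
  have e' : ∀ y, |(1 + a • 𝓜.T μ₀ π) x y| = (1 - a * 𝓜.muInf μ₀ x) * (if x = y then 1 else 0)
      + a * 𝓜.muInf μ₀ x * 𝓜.γ * (𝓜.P * policyMatrix π) x y := by
    intro y
    rw [e]
    refine abs_of_nonneg (add_nonneg (mul_nonneg (by linarith) ?_) (mul_nonneg ?_ (hPP y)))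
    · split_ifs <;> norm_num
    · positivity
  simp only [e', Finset.sum_add_distrib, ← Finset.mul_sum, hPs, Finset.sum_ite_eq,
    Finset.mem_univ, if_true, mul_one]
  have h1 := mul_le_mul_of_nonneg_left (𝓜.dMin_le μ₀ x)
    (mul_nonneg (sub_nonneg.2 𝓜.γ_lt_one.le) ha)
  linarith

end

/-- A matrix acts on the sup-norm with norm at most the largest `ℓ¹` norm of a row. -/
lemma norm_mulVec_le_of_sum_abs_le {X : Type w} [Fintype X] (M : Matrix X X ℝ) {q : ℝ}
    (hq : 0 ≤ q) (hM : ∀ x, ∑ y, |M x y| ≤ q) (v : X → ℝ) : ‖M *ᵥ v‖ ≤ q * ‖v‖ := by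
  refine (pi_norm_le_iff_of_nonneg (by positivity)).2 fun x => ?_
  calc ‖(M *ᵥ v) x‖ ≤ ∑ y, |M x y * v y| := Finset.abs_sum_le_sum_abs _ _
    _ ≤ ∑ y, |M x y| * ‖v‖ := Finset.sum_le_sum fun y _ => by
        rw [abs_mul]; gcongr; exact abs_apply_le_norm v y
    _ ≤ q * ‖v‖ := by rw [← Finset.sum_mul]; gcongr; exact hM x

section

variable {𝓜 : Model S A} {μ₀ : S × A → ℝ} [Nonempty S] [Nonempty A]

/-- The contraction rate `(1 - γ) d_min`. -/
noncomputable def rate (𝓜 : Model S A) (μ₀ : S × A → ℝ) : ℝ := (1 - 𝓜.γ) * 𝓜.dMin μ₀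

lemma PosStationary.rate_pos (h : 𝓜.PosStationary μ₀) : 0 < 𝓜.rate μ₀ :=
  mul_pos (sub_pos.2 𝓜.γ_lt_one) h.dMin_pos

lemma PosStationary.rate_le_one (h : 𝓜.PosStationary μ₀) : 𝓜.rate μ₀ ≤ 1 :=
  mul_le_one₀ (by linarith [𝓜.γ_nonneg]) h.dMin_pos.le (h.dMin_le_dMax.trans h.dMax_le_one)

lemma PosStationary.rate_mul_le_one (h : 𝓜.PosStationary μ₀) {a : ℝ} (ha : 0 ≤ a)
    (ha' : a ≤ 1) : 𝓜.rate μ₀ * a ≤ 1 := mul_le_one₀ h.rate_le_one ha ha'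

lemma PosStationary.norm_one_add_smul_T_mulVec_le (h : 𝓜.PosStationary μ₀) (π : S → A) {a : ℝ}
    (ha : 0 ≤ a) (ha' : a ≤ 1) (v : S × A → ℝ) :
    ‖(1 + a • 𝓜.T μ₀ π) *ᵥ v‖ ≤ (1 - 𝓜.rate μ₀ * a) * ‖v‖ :=
  norm_mulVec_le_of_sum_abs_le _ (sub_nonneg.2 (h.rate_mul_le_one ha ha'))
    (h.sum_abs_one_add_smul_T_le π ha ha') v

end

end Model

end QLearning

/-! ### The Lyapunov equation and explicit bounds on the step-size parameters -/

namespace QLearning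

section EuclideanNorm

variable {X : Type w} [Fintype X]

lemma norm2_nonneg (x : X → ℝ) : 0 ≤ norm2 x := norm_nonneg _

lemma norm2_sq (x : X → ℝ) : norm2 x ^ 2 = x ⬝ᵥ x := by
  rw [norm2, EuclideanSpace.real_norm_sq_eq]
  exact Finset.sum_congr rfl fun i _ => sq _

lemma norm_le_norm2 (x : X → ℝ) : ‖x‖ ≤ norm2 x :=
  (pi_norm_le_iff_of_nonneg (norm2_nonneg x)).2 fun i =>
    PiLp.norm_apply_le (p := 2) (WithLp.toLp 2 x) i

lemma norm2_sq_le (x : X → ℝ) : norm2 x ^ 2 ≤ Fintype.card X * ‖x‖ ^ 2 := by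
  rw [norm2, EuclideanSpace.real_norm_sq_eq]
  calc ∑ i, x i ^ 2 ≤ ∑ _i : X, ‖x‖ ^ 2 := Finset.sum_le_sum fun i _ => by
        rw [← sq_abs]; exact pow_le_pow_left₀ (abs_nonneg _) (norm_le_pi_norm x i) 2
    _ = _ := by simp

lemma dotProduct_le_norm2_mul (x y : X → ℝ) : |x ⬝ᵥ y| ≤ norm2 x * norm2 y := by
  refine abs_le_of_sq_le_sq ?_ (mul_nonneg (norm2_nonneg _) (norm2_nonneg _))
  rw [mul_pow, norm2_sq, norm2_sq]
  simpa only [dotProduct, ← sq] using Finset.sum_mul_sq_le_sq_mul_sq Finset.univ x y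

variable [DecidableEq X]

lemma opNorm2_nonneg (M : Matrix X X ℝ) : 0 ≤ opNorm2 M := norm_nonneg _

lemma opNorm2_mul_le (M N : Matrix X X ℝ) : opNorm2 (M * N) ≤ opNorm2 M * opNorm2 N := by
  rw [opNorm2, map_mul]
  exact norm_mul_le _ _

open scoped Matrix.Norms.L2Operator in
lemma opNorm2_transpose_mul_self (M : Matrix X X ℝ) :
    opNorm2 (Mᵀ * M) = opNorm2 M * opNorm2 M := by
  rw [← conjTranspose_eq_transpose_of_trivial, opNorm2, opNorm2, l2_opNorm_toEuclideanCLM,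
    l2_opNorm_toEuclideanCLM, l2_opNorm_conjTranspose_mul_self]

lemma norm2_mulVec_le (M : Matrix X X ℝ) (x : X → ℝ) : norm2 (M *ᵥ x) ≤ opNorm2 M * norm2 x := by
  rw [norm2, ← toEuclideanCLM_toLp]
  exact ContinuousLinearMap.le_opNorm _ _

lemma opNorm2_le_of_norm2_mulVec_le (M : Matrix X X ℝ) {K : ℝ} (hK : 0 ≤ K)
    (h : ∀ x, norm2 (M *ᵥ x) ≤ K * norm2 x) : opNorm2 M ≤ K := by
  refine ContinuousLinearMap.opNorm_le_bound _ hK fun x => ?_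
  have := h x.ofLp
  rwa [norm2, ← toEuclideanCLM_toLp] at this

end EuclideanNorm

namespace Model

lemma one_le_card {S : Type u} {A : Type v} [Fintype S] [Fintype A] [Nonempty S] [Nonempty A] :
    (1 : ℝ) ≤ Fintype.card S * Fintype.card A := by
  have : 1 ≤ Fintype.card S * Fintype.card A :=
    Nat.mul_pos Fintype.card_pos Fintype.card_pos
  exact_mod_cast this

namespace IsLyapunov

variable {X : Type w} [Fintype X] [DecidableEq X] {T G : Matrix X X ℝ}

lemma transpose_eq (h : IsLyapunov T G) : Gᵀ = G := by
  rw [← conjTranspose_eq_transpose_of_trivial]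
  exact h.1.isHermitian

lemma sqrt_transpose (G : Matrix X X ℝ) : (CFC.sqrt G)ᵀ = CFC.sqrt G := by
  have := (nonneg_iff_posSemidef.1 (CFC.sqrt_nonneg G)).isHermitian
  rwa [IsHermitian, conjTranspose_eq_transpose_of_trivial] at this

lemma sqrt_mul_sqrt (h : IsLyapunov T G) : CFC.sqrt G * CFC.sqrt G = G :=
  CFC.sqrt_mul_sqrt_self G (nonneg_iff_posSemidef.2 h.1.posSemidef)

lemma opNorm2_eq (h : IsLyapunov T G) :
    opNorm2 G = opNorm2 (CFC.sqrt G) * opNorm2 (CFC.sqrt G) := by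
  rw [← opNorm2_transpose_mul_self, sqrt_transpose, h.sqrt_mul_sqrt]

lemma opNorm2_inv_eq (h : IsLyapunov T G) :
    opNorm2 G⁻¹ = opNorm2 (CFC.sqrt G)⁻¹ * opNorm2 (CFC.sqrt G)⁻¹ := by
  rw [← opNorm2_transpose_mul_self, transpose_nonsing_inv, sqrt_transpose, ← Matrix.mul_inv_rev,
    h.sqrt_mul_sqrt]

lemma dotProduct_mulVec_eq (h : IsLyapunov T G) (x : X → ℝ) :
    2 * ((G *ᵥ x) ⬝ᵥ (T *ᵥ x)) = -(x ⬝ᵥ x) := by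
  have e := congrArg (fun M => x ⬝ᵥ (M *ᵥ x)) h.2
  simp only [add_mulVec, dotProduct_add, ← mulVec_mulVec, neg_mulVec, one_mulVec,
    dotProduct_neg] at e
  have e1 : x ⬝ᵥ (Tᵀ *ᵥ (G *ᵥ x)) = (G *ᵥ x) ⬝ᵥ (T *ᵥ x) := by
    rw [dotProduct_mulVec, vecMul_transpose, dotProduct_comm]
  have e2 : x ⬝ᵥ (G *ᵥ (T *ᵥ x)) = (G *ᵥ x) ⬝ᵥ (T *ᵥ x) := by
    rw [dotProduct_mulVec, ← mulVec_transpose, h.transpose_eq]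
  rw [e1, e2] at e
  linarith

lemma quad_nonneg (h : IsLyapunov T G) (x : X → ℝ) : 0 ≤ x ⬝ᵥ (G *ᵥ x) := by
  simpa using h.1.posSemidef.dotProduct_mulVec_nonneg x

/-- One step of the explicit Euler scheme loses at most `|x|²` of the Lyapunov function. -/
lemma quad_le (h : IsLyapunov T G) (x : X → ℝ) :
    x ⬝ᵥ (G *ᵥ x) ≤ ((1 + T) *ᵥ x) ⬝ᵥ (G *ᵥ ((1 + T) *ᵥ x)) + x ⬝ᵥ x := by
  have e1 := h.dotProduct_mulVec_eq x
  have e2 := h.quad_nonneg (T *ᵥ x)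
  have e3 : x ⬝ᵥ (G *ᵥ (T *ᵥ x)) = (G *ᵥ x) ⬝ᵥ (T *ᵥ x) := by
    rw [dotProduct_mulVec, ← mulVec_transpose, h.transpose_eq]
  rw [add_mulVec, one_mulVec, mulVec_add, dotProduct_add, add_dotProduct, add_dotProduct, e3,
    dotProduct_comm (T *ᵥ x) (G *ᵥ x)]
  linarith

/-- A discrete substitute for `G = ∫ exp(tTᵀ) exp(tT) dt`: along `y_k = (1 + T)^k x` the Lyapunov
function drops by at most `|y_k|²` per step and tends to zero, so its initial value is at most `∑
|y_k|²`, which the contraction bounds by a geometric series. -/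
lemma quad_le_of_contraction (h : IsLyapunov T G) {κ : ℝ} (hκ : 0 < κ) (hκ' : κ ≤ 1)
    (hT : ∀ v, ‖(1 + T) *ᵥ v‖ ≤ (1 - κ) * ‖v‖) (x : X → ℝ) :
    x ⬝ᵥ (G *ᵥ x) ≤ Fintype.card X / κ * ‖x‖ ^ 2 := by
  set y : ℕ → X → ℝ := fun k => (fun v => (1 + T) *ᵥ v)^[k] x with hy
  have hy1 : ∀ k, y (k + 1) = (1 + T) *ᵥ y k := fun k => Function.iterate_succ_apply' _ _ _
  have hyn : ∀ k, ‖y k‖ ≤ (1 - κ) ^ k * ‖x‖ := by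
    intro k
    induction k with
    | zero => simp [hy]
    | succ k ih =>
      rw [hy1, pow_succ']
      calc _ ≤ (1 - κ) * ‖y k‖ := hT _
        _ ≤ (1 - κ) * ((1 - κ) ^ k * ‖x‖) := mul_le_mul_of_nonneg_left ih (by linarith)
        _ = _ := by ring
  have hq : 0 ≤ 1 - κ := by linarith
  have hq1 : 1 - κ < 1 := by linarith
  have hsum : ∀ N, x ⬝ᵥ (G *ᵥ x) ≤ y N ⬝ᵥ (G *ᵥ y N)
      + Fintype.card X * ‖x‖ ^ 2 * ∑ k ∈ Finset.range N, (1 - κ) ^ k := by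
    intro N
    induction N with
    | zero => simp [hy]
    | succ N ih =>
      have h1 := h.quad_le (y N)
      rw [← hy1] at h1
      have h2 : y N ⬝ᵥ y N ≤ Fintype.card X * ‖x‖ ^ 2 * (1 - κ) ^ N := by
        rw [← norm2_sq]
        calc _ ≤ Fintype.card X * ‖y N‖ ^ 2 := norm2_sq_le _
          _ ≤ Fintype.card X * ((1 - κ) ^ N * ‖x‖) ^ 2 := by gcongr; exact hyn N
          _ = Fintype.card X * ‖x‖ ^ 2 * ((1 - κ) ^ N * (1 - κ) ^ N) := by ring
          -- Discarding half of the decay leaves the ratio `1 - κ`, whose geometric series sums to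
          -- `1 / κ`.
          _ ≤ Fintype.card X * ‖x‖ ^ 2 * ((1 - κ) ^ N * 1) := by
            gcongr
            exact pow_le_one₀ hq hq1.le
          _ = _ := by ring
      rw [Finset.sum_range_succ, mul_add]
      linarith
  have hlim : Tendsto y atTop (𝓝 0) := by
    refine squeeze_zero_norm hyn ?_
    simpa using (tendsto_pow_atTop_nhds_zero_of_lt_one hq hq1).mul_const ‖x‖
  have hV : Tendsto (fun N => y N ⬝ᵥ (G *ᵥ y N)) atTop (𝓝 0) := by
    have hc : Continuous fun v : X → ℝ => v ⬝ᵥ (G *ᵥ v) := by fun_prop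
    have h0 := (hc.tendsto 0).comp hlim
    rwa [zero_dotProduct] at h0
  have hg := (hasSum_geometric_of_lt_one hq hq1).tendsto_sum_nat
  rw [sub_sub_cancel] at hg
  have := ge_of_tendsto' (hV.add (hg.const_mul (Fintype.card X * ‖x‖ ^ 2))) hsum
  calc _ ≤ _ := this
    _ = _ := by ring

/-- A sup-norm contraction `I + T` bounds the solution of the Lyapunov equation. -/
lemma opNorm2_le (h : IsLyapunov T G) {κ : ℝ} (hκ : 0 < κ) (hκ' : κ ≤ 1)
    (hT : ∀ v, ‖(1 + T) *ᵥ v‖ ≤ (1 - κ) * ‖v‖) : opNorm2 G ≤ Fintype.card X / κ := by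
  have hK : (0 : ℝ) ≤ Fintype.card X / κ := by positivity
  -- The square root turns the bound on the quadratic form into a bound on an operator norm, as
  -- `|G^{1/2} x|² = x ⬝ G x`; the sup-norm is then dominated by the Euclidean one.
  have hs : opNorm2 (CFC.sqrt G) ≤ √(Fintype.card X / κ) := by
    refine opNorm2_le_of_norm2_mulVec_le _ (Real.sqrt_nonneg _) fun x => ?_
    refine abs_le_of_sq_le_sq' ?_ (mul_nonneg (Real.sqrt_nonneg _) (norm2_nonneg _)) |>.2
    rw [mul_pow, Real.sq_sqrt hK, norm2_sq]
    have e : (CFC.sqrt G *ᵥ x) ⬝ᵥ (CFC.sqrt G *ᵥ x) = x ⬝ᵥ (G *ᵥ x) := by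
      conv_rhs => rw [← h.sqrt_mul_sqrt, ← mulVec_mulVec, dotProduct_mulVec, ← mulVec_transpose,
        sqrt_transpose]
    rw [e]
    refine (h.quad_le_of_contraction hκ hκ' hT x).trans ?_
    gcongr
    exact norm_le_norm2 x
  rw [h.opNorm2_eq, ← Real.mul_self_sqrt hK]
  exact mul_self_le_mul_self (opNorm2_nonneg _) hs

/-- With `x = G⁻¹ z`, the Lyapunov equation tested on `x` reads `|x|² = -2 z ⬝ T x`, and
Cauchy–Schwarz leaves one factor `|x|` to cancel. -/
lemma opNorm2_inv_le (h : IsLyapunov T G) : opNorm2 G⁻¹ ≤ 2 * opNorm2 T := by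
  have hT := opNorm2_nonneg T
  refine opNorm2_le_of_norm2_mulVec_le _ (by positivity) fun z => ?_
  have hdet : IsUnit G.det := (isUnit_iff_isUnit_det G).1 h.1.isUnit
  set x := G⁻¹ *ᵥ z with hx
  have hGx : G *ᵥ x = z := by rw [hx, mulVec_mulVec, mul_nonsing_inv G hdet, one_mulVec]
  have h1 := h.dotProduct_mulVec_eq x
  rw [hGx, ← norm2_sq] at h1
  have h2 := neg_le_of_abs_le (dotProduct_le_norm2_mul z (T *ᵥ x))
  have h3 := mul_le_mul_of_nonneg_left (norm2_mulVec_le T x) (norm2_nonneg z)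
  have h4 : norm2 x * norm2 x ≤ (2 * opNorm2 T * norm2 z) * norm2 x := by
    rw [← sq]
    linarith
  rcases (norm2_nonneg x).eq_or_lt with h0 | h0
  · rw [← h0]
    exact mul_nonneg (by positivity) (norm2_nonneg z)
  · exact le_of_mul_le_mul_right h4 h0

/-- Submultiplicativity, the identities `‖G^{±1/2}‖² = ‖G^{±1}‖`, and the bound on `‖G⁻¹‖`. -/
lemma opNorm2_similar_sq_le (h : IsLyapunov T G) :
    opNorm2 (similar T G) ^ 2 ≤ 2 * opNorm2 G * opNorm2 T ^ 3 := by
  have hT := opNorm2_nonneg T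
  have hH := opNorm2_nonneg (CFC.sqrt G)
  have hH' := opNorm2_nonneg (CFC.sqrt G)⁻¹
  have h1 : opNorm2 (similar T G)
      ≤ opNorm2 (CFC.sqrt G) * opNorm2 T * opNorm2 (CFC.sqrt G)⁻¹ :=
    (opNorm2_mul_le _ _).trans
      (mul_le_mul_of_nonneg_right (opNorm2_mul_le _ _) hH')
  calc opNorm2 (similar T G) ^ 2
      ≤ (opNorm2 (CFC.sqrt G) * opNorm2 T * opNorm2 (CFC.sqrt G)⁻¹) ^ 2 :=
        pow_le_pow_left₀ (opNorm2_nonneg _) h1 2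
    _ = opNorm2 G * opNorm2 T ^ 2 * opNorm2 G⁻¹ := by rw [h.opNorm2_eq, h.opNorm2_inv_eq]; ring
    _ ≤ opNorm2 G * opNorm2 T ^ 2 * (2 * opNorm2 T) :=
        mul_le_mul_of_nonneg_left h.opNorm2_inv_le
          (mul_nonneg (opNorm2_nonneg _) (by positivity))
    _ = _ := by ring

end IsLyapunov

section StepParam

variable {S : Type u} {A : Type v} [Fintype S] [Fintype A] [DecidableEq S] [DecidableEq A]
  [Nonempty S] [Nonempty A] {𝓜 : Model S A} {μ₀ : S × A → ℝ}

lemma PosStationary.opNorm2_T_le (h : 𝓜.PosStationary μ₀) (π : S → A) :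
    opNorm2 (𝓜.T μ₀ π) ≤ √(Fintype.card S * Fintype.card A) * (2 * 𝓜.dMax μ₀) := by
  have hd := h.dMax_nonneg
  refine opNorm2_le_of_norm2_mulVec_le _ (by positivity) fun x => ?_
  have hx := norm2_nonneg x
  refine abs_le_of_sq_le_sq' ?_ (by positivity) |>.2
  rw [mul_pow, mul_pow, Real.sq_sqrt (by positivity)]
  calc _ ≤ (Fintype.card (S × A) : ℝ) * ‖𝓜.T μ₀ π *ᵥ x‖ ^ 2 := norm2_sq_le _
    _ ≤ (Fintype.card (S × A) : ℝ) * (2 * 𝓜.dMax μ₀ * norm2 x) ^ 2 := by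
      gcongr
      refine (h.norm_T_mulVec_le π x).trans ?_
      gcongr
      exact norm_le_norm2 x
    _ = _ := by rw [Fintype.card_prod, Nat.cast_mul]; ring

variable {g : (S × A → ℝ) → S → A} {c θ ξ : ℝ}

lemma IsStepParam.two_le_rate_mul (hs : 𝓜.IsStepParam μ₀ g c θ ξ) (h : 𝓜.PosStationary μ₀) :
    2 ≤ 𝓜.rate μ₀ * θ := by
  have h1 : 2 / 𝓜.rate μ₀ ≤ θ := hs.θ_lower
  rwa [div_le_iff₀ h.rate_pos, mul_comm] at h1

lemma IsStepParam.two_le (hs : 𝓜.IsStepParam μ₀ g c θ ξ) (h : 𝓜.PosStationary μ₀) : 2 ≤ θ := by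
  have h1 := hs.two_le_rate_mul h
  have h2 := h.rate_le_one
  have h3 := h.rate_pos
  by_contra! h4
  nlinarith

/-- The contraction estimate is applied with step-size one, where the rate is `κ` itself. -/
lemma PosStationary.opNorm2_G_le (h : 𝓜.PosStationary μ₀) {π : S → A}
    {G : Matrix (S × A) (S × A) ℝ} (hG : IsLyapunov (𝓜.T μ₀ π) G) :
    opNorm2 G ≤ Fintype.card S * Fintype.card A / 𝓜.rate μ₀ := by
  have := IsLyapunov.opNorm2_le hG h.rate_pos h.rate_le_one fun v => by
    simpa using h.norm_one_add_smul_T_mulVec_le π zero_le_one le_rfl v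
  rwa [Fintype.card_prod, Nat.cast_mul] at this

/-- The eigenvalue term of the maximum is dominated by the other one. Replacing `c` by `max c 0`
makes the estimate independent of the sign of `c`. -/
lemma IsStepParam.theta_le (hs : 𝓜.IsStepParam μ₀ g c θ ξ) (h : 𝓜.PosStationary μ₀) :
    θ ≤ max c 0 * (Fintype.card S * Fintype.card A / 𝓜.rate μ₀) := by
  obtain ⟨G, hG, h1, -⟩ := hs.upper
  refine h1.trans ?_
  have := h.opNorm2_G_le hG
  rw [max_eq_right (by exact this)]
  have := h.rate_pos
  exact mul_le_mul_of_nonneg_right (le_max_left _ _) (by positivity)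

lemma IsStepParam.xi_le (hs : 𝓜.IsStepParam μ₀ g c θ ξ) (h : 𝓜.PosStationary μ₀) :
    ξ ≤ 16 * (1 + max c 0) ^ 4 *
      ((Fintype.card S * Fintype.card A : ℝ) ^ 8 * 𝓜.dMax μ₀ ^ 3 / 𝓜.rate μ₀ ^ 3) := by
  obtain ⟨G, hG, -, h2⟩ := hs.upper
  have hθ := hs.theta_le h
  have hθ2 := hs.two_le h
  have hκ := h.rate_pos
  have hd := h.dMax_nonneg
  have hn : (1 : ℝ) ≤ Fintype.card S * Fintype.card A := one_le_card
  have hT := h.opNorm2_T_le (g 𝓜.QStar)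
  have hG' := h.opNorm2_G_le hG
  have hB := hG.opNorm2_similar_sq_le
  have hT0 := opNorm2_nonneg (𝓜.T μ₀ (g 𝓜.QStar))
  have hG0 := opNorm2_nonneg G
  have hc : 0 ≤ max c 0 := le_max_right _ _
  set n : ℝ := Fintype.card S * Fintype.card A
  set κ := 𝓜.rate μ₀
  set d := 𝓜.dMax μ₀
  set K := max c 0
  set Y := n ^ 8 * d ^ 3 / κ ^ 3 with hY
  have hY0 : 0 ≤ Y := by positivity
  have hB' : opNorm2 (similar (𝓜.T μ₀ (g 𝓜.QStar)) G) ^ 2 ≤ 16 * n ^ 3 * d ^ 3 / κ := by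
    calc _ ≤ 2 * opNorm2 G * opNorm2 (𝓜.T μ₀ (g 𝓜.QStar)) ^ 3 := hB
      _ ≤ 2 * (n / κ) * (√n * (2 * d)) ^ 3 := by gcongr
      _ = 16 * n * (√n) ^ 3 * d ^ 3 / κ := by ring
      -- Rounding `n^{3/2}` up to `n²` is harmless: the target carries `n ^ 8`, while only `n ^ 5`
      -- is reached below.
      _ ≤ 16 * n * n ^ 2 * d ^ 3 / κ := by
        gcongr
        have h1 : √n ≤ n := Real.sqrt_le_self_iff.2 (Or.inr hn) 
        have h2 : √n ^ 2 = n := Real.sq_sqrt (by positivity)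
        nlinarith [Real.sqrt_nonneg n]
      _ = _ := by ring
  have h3 : θ ^ 2 * opNorm2 (similar (𝓜.T μ₀ (g 𝓜.QStar)) G) ^ 2 ≤ 16 * K ^ 2 * Y := by
    calc _ ≤ (K * (n / κ)) ^ 2 * (16 * n ^ 3 * d ^ 3 / κ) := by gcongr
      _ = 16 * K ^ 2 * (n ^ 5 * d ^ 3 / κ ^ 3) := by field_simp
      _ ≤ 16 * K ^ 2 * Y := by rw [hY]; gcongr; norm_num
  have h4 : max (θ ^ 2 * opNorm2 (similar (𝓜.T μ₀ (g 𝓜.QStar)) G) ^ 2) Y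
      ≤ (16 * K ^ 2 + 1) * Y :=
    max_le (by linarith) (by nlinarith [mul_nonneg (sq_nonneg K) hY0])
  have h5 : 0 ≤ max (θ ^ 2 * opNorm2 (similar (𝓜.T μ₀ (g 𝓜.QStar)) G) ^ 2) Y :=
    hY0.trans (le_max_right _ _)
  calc ξ ≤ c * max (θ ^ 2 * opNorm2 (similar (𝓜.T μ₀ (g 𝓜.QStar)) G) ^ 2) Y := h2
    _ ≤ K * ((16 * K ^ 2 + 1) * Y) := mul_le_mul (le_max_left _ _) h4 h5 hc
    _ = (K * (16 * K ^ 2 + 1)) * Y := by ring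
    _ ≤ _ := by
      refine mul_le_mul_of_nonneg_right ?_ hY0
      nlinarith [pow_nonneg hc 2, pow_nonneg hc 3, pow_nonneg hc 4]

end StepParam

end Model

end QLearning

/-! ### The temporal-difference direction, its stationary mean and the noise -/

namespace QLearning

namespace Model

variable {S : Type u} {A : Type v} [Fintype S] [Fintype A]

/-- The bound `1 / (1 - γ)` of the iterates. -/
noncomputable def horizon (𝓜 : Model S A) : ℝ := 1 / (1 - 𝓜.γ)

lemma horizon_eq (𝓜 : Model S A) : 𝓜.horizon = 1 + 𝓜.γ * 𝓜.horizon := by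
  have : 1 - 𝓜.γ ≠ 0 := (sub_pos.2 𝓜.γ_lt_one).ne'
  rw [horizon]
  field_simp
  ring

lemma one_le_horizon (𝓜 : Model S A) : 1 ≤ 𝓜.horizon := by
  rw [horizon, le_div_iff₀ (sub_pos.2 𝓜.γ_lt_one)]
  linarith [𝓜.γ_nonneg]

section Max

variable [Nonempty A]

lemma abs_iSup_le (Q : S × A → ℝ) (s : S) {B : ℝ} (h : ‖Q‖ ≤ B) : |⨆ a, Q (s, a)| ≤ B := by
  obtain ⟨a, ha⟩ := exists_eq_ciSup_of_finite (f := fun a => Q (s, a))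
  rw [← ha]
  exact (abs_apply_le_norm Q _).trans h

lemma iSup_sub_iSup_le (Q Q' : S × A → ℝ) (s : S) :
    (⨆ a, Q (s, a)) - (⨆ a, Q' (s, a)) ≤ ‖Q - Q'‖ := by
  obtain ⟨a, ha⟩ := exists_eq_ciSup_of_finite (f := fun a => Q (s, a))
  rw [← ha]
  have h1 : Q' (s, a) ≤ ⨆ a, Q' (s, a) := le_ciSup (f := fun a => Q' (s, a))
    (Set.finite_range _).bddAbove a
  have h2 := (le_abs_self _).trans (abs_apply_le_norm (Q - Q') (s, a))
  rw [Pi.sub_apply] at h2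
  linarith

lemma abs_iSup_sub_iSup_le (Q Q' : S × A → ℝ) (s : S) :
    |(⨆ a, Q (s, a)) - (⨆ a, Q' (s, a))| ≤ ‖Q - Q'‖ :=
  abs_sub_le_iff.2 ⟨iSup_sub_iSup_le Q Q' s, norm_sub_rev Q Q' ▸ iSup_sub_iSup_le Q' Q s⟩

omit [Fintype S] in
lemma iSup_eq_of_isGreedy {g : (S × A → ℝ) → S → A} (hg : IsGreedy g) (Q : S × A → ℝ) (s : S) :
    ⨆ a, Q (s, a) = Q (s, g Q s) :=
  le_antisymm (ciSup_le fun a => hg Q s a)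
    (le_ciSup (f := fun a => Q (s, a)) (Set.finite_range _).bddAbove _)

end Max

variable [DecidableEq S] [DecidableEq A] {𝓜 : Model S A} {μ₀ : S × A → ℝ}

/-- The stationary mean `D_∞ R + γ D_∞ P Π_Q Q - D_∞ Q` of the temporal-difference direction. -/
noncomputable def drift (𝓜 : Model S A) (μ₀ : S × A → ℝ) (g : (S × A → ℝ) → S → A)
    (Q : S × A → ℝ) : S × A → ℝ :=
  𝓜.D μ₀ *ᵥ 𝓜.R + 𝓜.T μ₀ (g Q) *ᵥ Q

lemma noise_eq (g : (S × A → ℝ) → S → A) (Q : S × A → ℝ) (x : S × A) (s' : S) :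
    𝓜.noise μ₀ g Q x s' = 𝓜.td Q x s' - 𝓜.drift μ₀ g Q := rfl

variable [Nonempty A]

omit [DecidableEq S] [DecidableEq A] in
lemma abs_td_scalar_le {Q : S × A → ℝ} (hQ : ‖Q‖ ≤ 𝓜.horizon) (x : S × A) (s' : S) :
    |𝓜.r x s' + 𝓜.γ * (⨆ a, Q (s', a)) - Q x| ≤ 2 * 𝓜.horizon := by
  have h1 := abs_le.1 (𝓜.r_bound x s')
  have h2 := abs_iSup_le Q s' hQ
  have h3 := abs_le.1 ((abs_apply_le_norm Q x).trans hQ)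
  have h4 : |𝓜.γ * (⨆ a, Q (s', a))| ≤ 𝓜.γ * 𝓜.horizon := by
    rw [abs_mul, abs_of_nonneg 𝓜.γ_nonneg]
    exact mul_le_mul_of_nonneg_left h2 𝓜.γ_nonneg
  have h5 := abs_le.1 h4
  have h6 := 𝓜.horizon_eq
  exact abs_le.2 ⟨by linarith, by linarith⟩

lemma norm_td_le {Q : S × A → ℝ} (hQ : ‖Q‖ ≤ 𝓜.horizon) (x : S × A) (s' : S) :
    ‖𝓜.td Q x s'‖ ≤ 2 * 𝓜.horizon := by
  rw [td, Pi.norm_single]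
  exact abs_td_scalar_le hQ x s'

lemma norm_td_sub_le (Q Q' : S × A → ℝ) (x : S × A) (s' : S) :
    ‖𝓜.td Q x s' - 𝓜.td Q' x s'‖ ≤ 2 * ‖Q - Q'‖ := by
  rw [td, td, ← Pi.single_sub, Pi.norm_single, Real.norm_eq_abs]
  have h1 := abs_iSup_sub_iSup_le Q Q' s'
  have h2 := abs_apply_le_norm (Q - Q') x
  rw [Pi.sub_apply] at h2
  have e : 𝓜.r x s' + 𝓜.γ * (⨆ a, Q (s', a)) - Q x
      - (𝓜.r x s' + 𝓜.γ * (⨆ a, Q' (s', a)) - Q' x)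
      = 𝓜.γ * ((⨆ a, Q (s', a)) - (⨆ a, Q' (s', a))) - (Q x - Q' x) := by ring
  rw [e]
  refine (abs_sub _ _).trans ?_
  rw [abs_mul, abs_of_nonneg 𝓜.γ_nonneg]
  have h3 := mul_le_of_le_one_left (abs_nonneg ((⨆ a, Q (s', a)) - (⨆ a, Q' (s', a))))
    𝓜.γ_lt_one.le
  linarith

/-- The drift is the average of the temporal-difference direction over a stationary transition. -/
lemma drift_apply {g : (S × A → ℝ) → S → A} (hg : IsGreedy g) (Q : S × A → ℝ) (y : S × A) :
    𝓜.drift μ₀ g Q y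
      = ∑ a, 𝓜.muInf μ₀ a * ∑ b, 𝓜.chain a b * 𝓜.td Q a b.1 y := by
  have h1 : ∀ a, ∑ b, 𝓜.chain a b * 𝓜.td Q a b.1 y
      = ∑ s', 𝓜.P a s' * 𝓜.td Q a s' y := fun a => 𝓜.sum_chain_mul a fun s' => 𝓜.td Q a s' y
  simp only [h1]
  -- The direction is supported on the visited pair, so only visits to `y` contribute to coordinate
  -- `y`.
  rw [Finset.sum_eq_single y]
  · simp only [td, Pi.single_eq_same]
    rw [drift, Pi.add_apply, T_mulVec, D, Matrix.mulVec_diagonal, R]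
    simp only [mul_sub, mul_add, Finset.sum_sub_distrib, Finset.sum_add_distrib,
      ← Finset.sum_mul, 𝓜.P_sum, iSup_eq_of_isGreedy hg, Finset.mul_sum]
    have : ∀ s', 𝓜.muInf μ₀ y * (𝓜.P y s' * (𝓜.γ * Q (s', g Q s')))
        = 𝓜.muInf μ₀ y * (𝓜.γ * (𝓜.P y s' * Q (s', g Q s'))) := fun s' => by ring
    simp only [this]
    ring
  · intro a _ ha
    simp [td, Pi.single_eq_of_ne ha.symm]
  · simp

omit [Nonempty A] in
lemma PosStationary.abs_average_le (h : 𝓜.PosStationary μ₀) (f : S × A → S × A → ℝ) {B : ℝ}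
    (hf : ∀ a b, |f a b| ≤ B) :
    |∑ a, 𝓜.muInf μ₀ a * ∑ b, 𝓜.chain a b * f a b| ≤ B := by
  have h1 : ∀ a, |∑ b, 𝓜.chain a b * f a b| ≤ B := fun a => by
    calc _ ≤ ∑ b, |𝓜.chain a b * f a b| := Finset.abs_sum_le_sum_abs _ _
      _ ≤ ∑ b, 𝓜.chain a b * B := Finset.sum_le_sum fun b _ => by
        rw [abs_mul, abs_of_nonneg (𝓜.chain_nonneg a b)]
        exact mul_le_mul_of_nonneg_left (hf a b) (𝓜.chain_nonneg a b)
      _ = B := by rw [← Finset.sum_mul, 𝓜.chain_sum, one_mul]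
  calc _ ≤ ∑ a, |𝓜.muInf μ₀ a * ∑ b, 𝓜.chain a b * f a b| := Finset.abs_sum_le_sum_abs _ _
    _ ≤ ∑ a, 𝓜.muInf μ₀ a * B := Finset.sum_le_sum fun a _ => by
      rw [abs_mul, abs_of_pos (h.pos a)]
      exact mul_le_mul_of_nonneg_left (h1 a) (h.pos a).le
    _ = B := by rw [← Finset.sum_mul, h.sum, one_mul]

lemma PosStationary.norm_drift_le (h : 𝓜.PosStationary μ₀) {g : (S × A → ℝ) → S → A}
    (hg : IsGreedy g) {Q : S × A → ℝ} (hQ : ‖Q‖ ≤ 𝓜.horizon) :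
    ‖𝓜.drift μ₀ g Q‖ ≤ 2 * 𝓜.horizon := by
  refine (pi_norm_le_iff_of_nonneg (by linarith [𝓜.one_le_horizon])).2 fun y => ?_
  rw [drift_apply hg]
  exact h.abs_average_le _ fun a b => (abs_apply_le_norm _ y).trans (norm_td_le hQ a b.1)

/-- The matrix `Π_Q` jumps as `Q` varies, but `Π_Q Q` is a maximum and is Lipschitz. Averaging the
Lipschitz bound for the temporal-difference direction makes this visible. -/
lemma PosStationary.norm_drift_sub_le (h : 𝓜.PosStationary μ₀) {g : (S × A → ℝ) → S → A}
    (hg : IsGreedy g) (Q Q' : S × A → ℝ) :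
    ‖𝓜.drift μ₀ g Q - 𝓜.drift μ₀ g Q'‖ ≤ 2 * ‖Q - Q'‖ := by
  refine (pi_norm_le_iff_of_nonneg (by positivity)).2 fun y => ?_
  rw [Pi.sub_apply, drift_apply hg, drift_apply hg, ← Finset.sum_sub_distrib]
  have e : ∀ a, 𝓜.muInf μ₀ a * ∑ b, 𝓜.chain a b * 𝓜.td Q a b.1 y
      - 𝓜.muInf μ₀ a * ∑ b, 𝓜.chain a b * 𝓜.td Q' a b.1 y
      = 𝓜.muInf μ₀ a * ∑ b, 𝓜.chain a b * (𝓜.td Q a b.1 - 𝓜.td Q' a b.1) y := fun a => by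
    simp only [Pi.sub_apply, mul_sub, Finset.sum_sub_distrib]
  simp only [e]
  exact h.abs_average_le _ fun a b => (abs_apply_le_norm _ y).trans (norm_td_sub_le Q Q' a b.1)

lemma PosStationary.norm_noise_le (h : 𝓜.PosStationary μ₀) {g : (S × A → ℝ) → S → A}
    (hg : IsGreedy g) {Q : S × A → ℝ} (hQ : ‖Q‖ ≤ 𝓜.horizon) (x : S × A) (s' : S) :
    ‖𝓜.noise μ₀ g Q x s'‖ ≤ 4 * 𝓜.horizon := by
  rw [noise_eq]
  linarith [norm_sub_le (𝓜.td Q x s') (𝓜.drift μ₀ g Q), norm_td_le hQ x s', h.norm_drift_le hg hQ]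

lemma PosStationary.norm_noise_sub_le (h : 𝓜.PosStationary μ₀) {g : (S × A → ℝ) → S → A}
    (hg : IsGreedy g) (Q Q' : S × A → ℝ) (x : S × A) (s' : S) :
    ‖𝓜.noise μ₀ g Q x s' - 𝓜.noise μ₀ g Q' x s'‖ ≤ 4 * ‖Q - Q'‖ := by
  rw [noise_eq, noise_eq, sub_sub_sub_comm]
  linarith [norm_sub_le (𝓜.td Q x s' - 𝓜.td Q' x s') (𝓜.drift μ₀ g Q - 𝓜.drift μ₀ g Q'),
    norm_td_sub_le (𝓜 := 𝓜) Q Q' x s', h.norm_drift_sub_le hg Q Q']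

/-- The conditional mean of the noise under a law of the state-action pair that is `ε`-close in
`ℓ¹` to the stationary one. -/
lemma abs_sum_noise_le {g : (S × A → ℝ) → S → A}
    (hg : IsGreedy g) {Q : S × A → ℝ} (hQ : ‖Q‖ ≤ 𝓜.horizon) (p : S × A → ℝ)
    (hp : ∑ a, p a = 1) {ε : ℝ} (hpε : ∑ a, |p a - 𝓜.muInf μ₀ a| ≤ ε) (y : S × A) :
    |∑ a, ∑ b, p a * 𝓜.chain a b * 𝓜.noise μ₀ g Q a b.1 y| ≤ 2 * 𝓜.horizon * ε := by
  -- Subtracting the stationary mean replaces the weights `p` by `p - μ_∞`, which are small in `ℓ¹`.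
  have e : ∑ a, ∑ b, p a * 𝓜.chain a b * 𝓜.noise μ₀ g Q a b.1 y
      = ∑ a, (p a - 𝓜.muInf μ₀ a) * ∑ b, 𝓜.chain a b * 𝓜.td Q a b.1 y := by
    have e1 : ∀ a, ∑ b, p a * 𝓜.chain a b * 𝓜.noise μ₀ g Q a b.1 y
        = p a * (∑ b, 𝓜.chain a b * 𝓜.td Q a b.1 y) - p a * 𝓜.drift μ₀ g Q y := fun a => by
      simp only [noise_eq, Pi.sub_apply, mul_sub, Finset.sum_sub_distrib, mul_assoc,
        ← Finset.mul_sum, ← Finset.sum_mul, 𝓜.chain_sum, one_mul]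
    simp only [e1, Finset.sum_sub_distrib, ← Finset.sum_mul, hp, one_mul, sub_mul]
    rw [drift_apply hg]
  have h1 : ∀ a, |∑ b, 𝓜.chain a b * 𝓜.td Q a b.1 y| ≤ 2 * 𝓜.horizon := fun a => by
    rw [𝓜.sum_chain_mul a fun s' => 𝓜.td Q a s' y]
    exact 𝓜.abs_sum_P_mul_le a _ fun s' => (abs_apply_le_norm _ y).trans (norm_td_le hQ a s')
  have hL := 𝓜.one_le_horizon
  rw [e]
  calc _ ≤ ∑ a, |(p a - 𝓜.muInf μ₀ a) * ∑ b, 𝓜.chain a b * 𝓜.td Q a b.1 y| :=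
        Finset.abs_sum_le_sum_abs _ _
    _ ≤ ∑ a, |p a - 𝓜.muInf μ₀ a| * (2 * 𝓜.horizon) := Finset.sum_le_sum fun a _ => by
        rw [abs_mul]
        exact mul_le_mul_of_nonneg_left (h1 a) (abs_nonneg _)
    _ ≤ ε * (2 * 𝓜.horizon) := by rw [← Finset.sum_mul]; gcongr
    _ = _ := by ring

section Iterates

variable {α : ℕ → ℝ} {Q₀ : S × A → ℝ}

/-- The updated coordinate is a convex combination of its old value and a target of size at most `1
+ γ · horizon = horizon`; the others do not move. -/
lemma norm_Qiter_le (hα : ∀ k, 0 ≤ α k) (hα' : ∀ k, α k ≤ 1) (hQ₀ : ‖Q₀‖ ≤ 1)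
    (z : ℕ → S × A) (k : ℕ) : ‖𝓜.Qiter α Q₀ z k‖ ≤ 𝓜.horizon := by
  have hL := 𝓜.one_le_horizon
  induction k with
  | zero => exact hQ₀.trans hL
  | succ k ih =>
    rw [Qiter]
    set Q := 𝓜.Qiter α Q₀ z k
    refine (pi_norm_le_iff_of_nonneg (by linarith)).2 fun y => ?_
    have hy := abs_le.1 ((abs_apply_le_norm Q y).trans ih)
    rw [Pi.add_apply, Pi.smul_apply, smul_eq_mul, Real.norm_eq_abs, td]
    rcases eq_or_ne y (z k) with rfl | hne
    · rw [Pi.single_eq_same]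
      have h1 := abs_le.1 (𝓜.r_bound (z k) (z (k + 1)).1)
      have h4 : |𝓜.γ * (⨆ a, Q ((z (k + 1)).1, a))| ≤ 𝓜.γ * 𝓜.horizon := by
        rw [abs_mul, abs_of_nonneg 𝓜.γ_nonneg]
        exact mul_le_mul_of_nonneg_left (abs_iSup_le Q _ ih) 𝓜.γ_nonneg
      have h5 := abs_le.1 h4
      have h6 := 𝓜.horizon_eq
      have ha := hα k
      have ha' := sub_nonneg.2 (hα' k)
      set u := 𝓜.r (z k) (z (k + 1)).1 + 𝓜.γ * (⨆ a, Q ((z (k + 1)).1, a))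
      have e : Q (z k) + α k * (u - Q (z k)) = (1 - α k) * Q (z k) + α k * u := by ring
      rw [e]
      have hu1 : u ≤ 𝓜.horizon := by linarith
      have hu2 : -𝓜.horizon ≤ u := by linarith
      have m1 := mul_le_mul_of_nonneg_left hu1 ha
      have m2 := mul_le_mul_of_nonneg_left hu2 ha
      have m3 := mul_le_mul_of_nonneg_left hy.1 ha'
      have m4 := mul_le_mul_of_nonneg_left hy.2 ha'
      exact abs_le.2 ⟨by linarith, by linarith⟩
    · rw [Pi.single_eq_of_ne hne, mul_zero, add_zero]
      exact abs_le.2 hy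

lemma norm_Qiter_succ_sub_le (hα : ∀ k, 0 ≤ α k) (hα' : ∀ k, α k ≤ 1) (hQ₀ : ‖Q₀‖ ≤ 1)
    (z : ℕ → S × A) (k : ℕ) :
    ‖𝓜.Qiter α Q₀ z (k + 1) - 𝓜.Qiter α Q₀ z k‖ ≤ 2 * 𝓜.horizon * α k := by
  rw [Qiter, add_sub_cancel_left, norm_smul, Real.norm_eq_abs, abs_of_nonneg (hα k), mul_comm]
  exact mul_le_mul_of_nonneg_right (norm_td_le (norm_Qiter_le hα hα' hQ₀ z k) _ _) (hα k)

lemma PosStationary.norm_noiseAt_le (h : 𝓜.PosStationary μ₀) {g : (S × A → ℝ) → S → A}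
    (hg : IsGreedy g) (hα : ∀ k, 0 ≤ α k) (hα' : ∀ k, α k ≤ 1) (hQ₀ : ‖Q₀‖ ≤ 1)
    (z : ℕ → S × A) (k : ℕ) : ‖𝓜.noiseAt μ₀ g α Q₀ z k‖ ≤ 4 * 𝓜.horizon :=
  h.norm_noise_le hg (norm_Qiter_le hα hα' hQ₀ z k) _ _

end Iterates

end Model

/-- Increments bounded along an antitone sequence of step sizes accumulate at most linearly. -/
lemma norm_sub_le_of_norm_succ_sub_le {E : Type w} [SeminormedAddCommGroup E] (f : ℕ → E)
    {α : ℕ → ℝ} (hα : Antitone α) {B : ℝ} (hB : 0 ≤ B)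
    (hf : ∀ k, ‖f (k + 1) - f k‖ ≤ B * α k) (i h : ℕ) :
    ‖f (i + h) - f i‖ ≤ B * (h * α i) := by
  induction h with
  | zero => simp
  | succ h ih =>
    have h1 : ‖f (i + h + 1) - f (i + h)‖ ≤ B * α i :=
      (hf _).trans (mul_le_mul_of_nonneg_left (hα (Nat.le_add_right i h)) hB)
    have h2 := norm_sub_le_norm_sub_add_norm_sub (f (i + h + 1)) (f (i + h)) (f i)
    rw [← add_assoc]
    push_cast
    linarith

end QLearning

/-! ### The Markov property along a trajectory -/

namespace QLearning

/-- `f` is a function of `Z 0, …, Z n`. -/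
def DeterminedBy {Ω : Type w} {X : Type u} {E : Type v} (Z : ℕ → Ω → X) (n : ℕ) (f : Ω → E) :
    Prop :=
  ∀ ω ω', (∀ i, i ≤ n → Z i ω = Z i ω') → f ω = f ω'

namespace DeterminedBy

variable {Ω : Type w} {X : Type u} {Z : ℕ → Ω → X} {n : ℕ}

lemma mono {E : Type v} {f : Ω → E} {k : ℕ} (h : DeterminedBy Z n f) (hnk : n ≤ k) :
    DeterminedBy Z k f :=
  fun ω ω' hω => h ω ω' fun i hi => hω i (hi.trans hnk)

lemma comp {E : Type v} {F : Type*} {f : Ω → E} (h : DeterminedBy Z n f) (φ : E → F) :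
    DeterminedBy Z n fun ω => φ (f ω) :=
  fun ω ω' hω => congrArg φ (h ω ω' hω)

lemma comp₂ {E F H : Type*} {f : Ω → E} {g : Ω → F} (hf : DeterminedBy Z n f)
    (hg : DeterminedBy Z n g) (φ : E → F → H) : DeterminedBy Z n fun ω => φ (f ω) (g ω) :=
  fun ω ω' hω => congrArg₂ φ (hf ω ω' hω) (hg ω ω' hω)

lemma coord {k : ℕ} (hk : k ≤ n) : DeterminedBy Z n (Z k) := fun _ _ hω => hω k hk

/-- Reduces random variables to functions on a path space, finite when `X` is; measurability,
integrability and decomposition into path indicators all rest on this. -/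
lemma exists_eq_comp {f : Ω → ℝ} (h : DeterminedBy Z n f) :
    ∃ F : (Fin (n + 1) → X) → ℝ, ∀ ω, f ω = F fun i => Z i ω := by
  have hf : Function.FactorsThrough f fun ω (i : Fin (n + 1)) => Z i ω := fun ω ω' hω =>
    h ω ω' fun i hi => congrFun hω ⟨i, Nat.lt_succ_of_le hi⟩
  obtain ⟨F, hF⟩ := (Function.factorsThrough_iff _).1 hf
  exact ⟨F, fun ω => congrFun hF ω⟩

end DeterminedBy

namespace Model.IsTrajectory

variable {S : Type u} {A : Type v} [Fintype S] [Fintype A] [DecidableEq S] [DecidableEq A]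
  {𝓜 : Model S A} {μ₀ : S × A → ℝ} {Ω : Type w} [MeasurableSpace Ω]
  {ℙ : Measure Ω} {Z : ℕ → Ω → S × A}

omit [DecidableEq S] [DecidableEq A] in
lemma measurableSet_history (hZ : 𝓜.IsTrajectory μ₀ ℙ Z) (n : ℕ) (z : ℕ → S × A) :
    MeasurableSet {ω | ∀ i, i ≤ n → Z i ω = z i} := by
  simp only [Set.ofPred_forall]
  exact MeasurableSet.iInter fun i => MeasurableSet.iInter fun _ => hZ.measurable i (z i)

omit [DecidableEq S] [DecidableEq A] in
lemma measurable_of_determinedBy (hZ : 𝓜.IsTrajectory μ₀ ℙ Z) {n : ℕ} {f : Ω → ℝ}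
    (hf : DeterminedBy Z n f) : Measurable f := by
  obtain ⟨F, hF⟩ := hf.exists_eq_comp
  let _ : MeasurableSpace (Fin (n + 1) → S × A) := ⊤
  have hm : Measurable fun ω (i : Fin (n + 1)) => Z i ω := by
    refine measurable_to_countable' fun p => ?_
    have : (fun ω (i : Fin (n + 1)) => Z i ω) ⁻¹' {p} = ⋂ i : Fin (n + 1), {ω | Z i ω = p i} := by
      ext ω
      simp [funext_iff]
    rw [this]
    exact MeasurableSet.iInter fun i => hZ.measurable i (p i)
  have : f = F ∘ fun ω (i : Fin (n + 1)) => Z i ω := funext hF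
  rw [this]
  exact measurable_from_top.comp hm

variable [IsProbabilityMeasure ℙ]

omit [DecidableEq S] [DecidableEq A] in
lemma integrable_of_determinedBy (hZ : 𝓜.IsTrajectory μ₀ ℙ Z) {n : ℕ} {f : Ω → ℝ}
    (hf : DeterminedBy Z n f) : Integrable f ℙ := by
  obtain ⟨F, hF⟩ := hf.exists_eq_comp
  refine Integrable.of_bound (hZ.measurable_of_determinedBy hf).aestronglyMeasurable
    (∑ p, ‖F p‖) (Eventually.of_forall fun ω => ?_)
  rw [hF]
  exact Finset.single_le_sum (f := fun p => ‖F p‖) (fun p _ => norm_nonneg _) (Finset.mem_univ _)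

omit [IsProbabilityMeasure ℙ] in
lemma integral_history_eq (hZ : 𝓜.IsTrajectory μ₀ ℙ Z) (hμ₀ : ∀ x, 0 ≤ μ₀ x) (n : ℕ)
    (z : ℕ → S × A) :
    ∫ ω, (if ∀ i, i ≤ n → Z i ω = z i then (1 : ℝ) else 0) ∂ℙ
      = μ₀ (z 0) * ∏ i ∈ Finset.range n, 𝓜.chain (z i) (z (i + 1)) := by
  have e : (fun ω => if ∀ i, i ≤ n → Z i ω = z i then (1 : ℝ) else 0)
      = {ω | ∀ i, i ≤ n → Z i ω = z i}.indicator 1 := by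
    ext ω
    simp [Set.indicator_apply]
  rw [e, integral_indicator_one (hZ.measurableSet_history n z), Measure.real, hZ.law_eq,
    ENNReal.toReal_ofReal]
  exact mul_nonneg (hμ₀ _) (Finset.prod_nonneg fun i _ => 𝓜.chain_nonneg _ _)

omit [IsProbabilityMeasure ℙ] in
/-- The Markov property, for the indicator of a history. -/
lemma integral_history_mul_next (hZ : 𝓜.IsTrajectory μ₀ ℙ Z) (hμ₀ : ∀ x, 0 ≤ μ₀ x) (n : ℕ)
    (z : ℕ → S × A) (a : S × A) :
    ∫ ω, (if ∀ i, i ≤ n → Z i ω = z i then (1 : ℝ) else 0)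
        * (if Z (n + 1) ω = a then 1 else 0) ∂ℙ
      = ∫ ω, (if ∀ i, i ≤ n → Z i ω = z i then (1 : ℝ) else 0) * 𝓜.chain (Z n ω) a ∂ℙ := by
  -- A history followed by `a` is again a history, one step longer, so its probability is given by
  -- `law_eq`.
  have e1 : ∀ ω, (if ∀ i, i ≤ n → Z i ω = z i then (1 : ℝ) else 0)
        * (if Z (n + 1) ω = a then 1 else 0)
      = if ∀ i, i ≤ n + 1 → Z i ω = Function.update z (n + 1) a i then (1 : ℝ) else 0 := by
    intro ω
    have : (∀ i, i ≤ n + 1 → Z i ω = Function.update z (n + 1) a i)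
        ↔ (∀ i, i ≤ n → Z i ω = z i) ∧ Z (n + 1) ω = a := by
      constructor
      · intro h
        refine ⟨fun i hi => ?_, by simpa using h (n + 1) le_rfl⟩
        simpa [Function.update_of_ne (show i ≠ n + 1 by omega)] using h i (by omega)
      · rintro ⟨h1, h2⟩ i hi
        rcases eq_or_ne i (n + 1) with rfl | hne
        · simpa using h2
        · rw [Function.update_of_ne hne]
          exact h1 i (by omega)
    simp only [this, ite_and]
    split_ifs <;> simp
  have e2 : ∀ ω, (if ∀ i, i ≤ n → Z i ω = z i then (1 : ℝ) else 0) * 𝓜.chain (Z n ω) a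
      = (if ∀ i, i ≤ n → Z i ω = z i then (1 : ℝ) else 0) * 𝓜.chain (z n) a := by
    intro ω
    split_ifs with h
    · rw [h n le_rfl]
    · simp
  simp only [e1, e2]
  rw [integral_mul_const, hZ.integral_history_eq hμ₀, hZ.integral_history_eq hμ₀,
    Finset.prod_range_succ, Function.update_self, Function.update_of_ne (by omega),
    Function.update_of_ne (by omega), mul_assoc]
  congr 2
  refine Finset.prod_congr rfl fun i hi => ?_
  have := Finset.mem_range.1 hi
  rw [Function.update_of_ne (by omega), Function.update_of_ne (by omega)]

/-- The one-step Markov property. -/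
lemma integral_mul_next (hZ : 𝓜.IsTrajectory μ₀ ℙ Z) (hμ₀ : ∀ x, 0 ≤ μ₀ x) {n : ℕ} {f : Ω → ℝ}
    (hf : DeterminedBy Z n f) (a : S × A) :
    ∫ ω, f ω * (if Z (n + 1) ω = a then 1 else 0) ∂ℙ = ∫ ω, f ω * 𝓜.chain (Z n ω) a ∂ℙ := by
  obtain ⟨F, hF⟩ := hf.exists_eq_comp
  -- Paths are extended to all of `ℕ` to fit `law_eq`; the values beyond time `n` are never read.
  set path : (Fin (n + 1) → S × A) → ℕ → S × A := fun p i => p (Fin.ofNat (n + 1) i) with hpath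
  have hiff : ∀ p ω, (∀ i, i ≤ n → Z i ω = path p i) ↔ (fun i : Fin (n + 1) => Z i ω) = p := by
    intro p ω
    constructor
    · intro h
      ext1 i
      rw [h i (Nat.le_of_lt_succ i.2)]
      exact congrArg p (Fin.ofNat_val_eq_self i)
    · rintro rfl i hi
      simp only [hpath, Fin.val_ofNat, Nat.mod_eq_of_lt (Nat.lt_succ_of_le hi)]
  -- A function of the history is a finite combination of path indicators, which reduces the claim
  -- to a single history.
  have hsum : ∀ ω (q : ℝ), f ω * q
      = ∑ p, F p * ((if ∀ i, i ≤ n → Z i ω = path p i then (1 : ℝ) else 0) * q) := by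
    intro ω q
    simp only [hiff, hF, ite_mul, one_mul, zero_mul, mul_ite, mul_zero, Finset.sum_ite_eq,
      Finset.mem_univ, if_true]
  have hdet : ∀ p, DeterminedBy Z n
      fun ω => if ∀ i, i ≤ n → Z i ω = path p i then (1 : ℝ) else 0 := by
    intro p ω ω' h
    have : (∀ i, i ≤ n → Z i ω = path p i) ↔ (∀ i, i ≤ n → Z i ω' = path p i) :=
      forall_congr' fun i => forall_congr' fun hi => by rw [h i hi]
    simp only [this]
  simp only [hsum]
  rw [integral_finsetSum, integral_finsetSum]
  · refine Finset.sum_congr rfl fun p _ => ?_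
    rw [integral_const_mul, integral_const_mul, hZ.integral_history_mul_next hμ₀]
  · exact fun p _ => (hZ.integrable_of_determinedBy ((hdet p).comp₂
      (DeterminedBy.coord le_rfl) fun u x => u * 𝓜.chain x a)).const_mul _
  · exact fun p _ => (hZ.integrable_of_determinedBy (((hdet p).mono (Nat.le_succ n)).comp₂
      (DeterminedBy.coord le_rfl) fun u x => u * if x = a then 1 else 0)).const_mul _

/-- The Markov property over `h` steps. -/
lemma integral_mul_later (hZ : 𝓜.IsTrajectory μ₀ ℙ Z) (hμ₀ : ∀ x, 0 ≤ μ₀ x) {n : ℕ} {f : Ω → ℝ}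
    (hf : DeterminedBy Z n f) (h : ℕ) (a : S × A) :
    ∫ ω, f ω * (if Z (n + h) ω = a then 1 else 0) ∂ℙ
      = ∫ ω, f ω * (𝓜.chain ^ h) (Z n ω) a ∂ℙ := by
  induction h generalizing a with
  | zero => simp [Matrix.one_apply]
  | succ h ih =>
    rw [← add_assoc, hZ.integral_mul_next hμ₀ (hf.mono (Nat.le_add_right n h))]
    have e1 : ∀ ω, f ω * 𝓜.chain (Z (n + h) ω) a
        = ∑ b, (f ω * (if Z (n + h) ω = b then 1 else 0)) * 𝓜.chain b a := by
      intro ω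
      simp
    have e2 : ∀ ω, f ω * (𝓜.chain ^ (h + 1)) (Z n ω) a
        = ∑ b, (f ω * (𝓜.chain ^ h) (Z n ω) b) * 𝓜.chain b a := by
      intro ω
      rw [pow_succ, Matrix.mul_apply, Finset.mul_sum]
      exact Finset.sum_congr rfl fun b _ => (mul_assoc _ _ _).symm
    simp only [e1, e2]
    rw [integral_finsetSum, integral_finsetSum]
    · refine Finset.sum_congr rfl fun b _ => ?_
      rw [integral_mul_const, integral_mul_const, ih]
    · exact fun b _ => (hZ.integrable_of_determinedBy (hf.comp₂
        (DeterminedBy.coord le_rfl) fun u x => u * (𝓜.chain ^ h) x b)).mul_const _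
    · exact fun b _ => (hZ.integrable_of_determinedBy ((hf.mono (Nat.le_add_right n h)).comp₂
        (DeterminedBy.coord le_rfl) fun u x => u * if x = b then 1 else 0)).mul_const _

/-- Conditional expectation, given `Z 0, …, Z n`, of a function of this history and of the
transition from time `n + h` to time `n + h + 1`. -/
lemma integral_transition (hZ : 𝓜.IsTrajectory μ₀ ℙ Z) (hμ₀ : ∀ x, 0 ≤ μ₀ x) {n : ℕ}
    {f : Ω → S × A → S × A → ℝ} (hf : DeterminedBy Z n f) (h : ℕ) :
    ∫ ω, f ω (Z (n + h) ω) (Z (n + h + 1) ω) ∂ℙ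
      = ∫ ω, ∑ a, ∑ b, (𝓜.chain ^ h) (Z n ω) a * 𝓜.chain a b * f ω a b ∂ℙ := by
  have hfab : ∀ a b, DeterminedBy Z n fun ω => f ω a b := fun a b => hf.comp fun F => F a b
  have e1 : ∀ ω, f ω (Z (n + h) ω) (Z (n + h + 1) ω)
      = ∑ a, ∑ b, (f ω a b * (if Z (n + h) ω = a then 1 else 0))
          * (if Z (n + h + 1) ω = b then 1 else 0) := by
    intro ω
    simp
  have hd1 : ∀ a b, DeterminedBy Z (n + h)
      fun ω => f ω a b * (if Z (n + h) ω = a then 1 else 0) := fun a b =>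
    ((hfab a b).mono (Nat.le_add_right n h)).comp₂ (DeterminedBy.coord le_rfl)
      fun u x => u * if x = a then 1 else 0
  have hi1 : ∀ a b, Integrable (fun ω => (f ω a b * (if Z (n + h) ω = a then 1 else 0))
      * (if Z (n + h + 1) ω = b then 1 else 0)) ℙ := fun a b =>
    hZ.integrable_of_determinedBy (((hd1 a b).mono (Nat.le_succ _)).comp₂
      (DeterminedBy.coord le_rfl) fun u x => u * if x = b then 1 else 0)
  have hi2 : ∀ a b, Integrable (fun ω => (𝓜.chain ^ h) (Z n ω) a * 𝓜.chain a b * f ω a b) ℙ :=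
    fun a b => hZ.integrable_of_determinedBy ((hfab a b).comp₂ (DeterminedBy.coord le_rfl)
      fun u x => (𝓜.chain ^ h) x a * 𝓜.chain a b * u)
  simp only [e1]
  rw [integral_finsetSum _ fun a _ => integrable_finsetSum _ fun b _ => hi1 a b,
    integral_finsetSum _ fun a _ => integrable_finsetSum _ fun b _ => hi2 a b]
  refine Finset.sum_congr rfl fun a _ => ?_
  rw [integral_finsetSum _ fun b _ => hi1 a b, integral_finsetSum _ fun b _ => hi2 a b]
  refine Finset.sum_congr rfl fun b _ => ?_
  rw [hZ.integral_mul_next hμ₀ (hd1 a b)]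
  have e2 : ∀ ω, f ω a b * (if Z (n + h) ω = a then 1 else 0) * 𝓜.chain (Z (n + h) ω) b
      = f ω a b * (if Z (n + h) ω = a then 1 else 0) * 𝓜.chain a b := by
    intro ω
    split_ifs with hz
    · rw [hz]
    · simp
  simp only [e2]
  rw [integral_mul_const, hZ.integral_mul_later hμ₀ (hfab a b), ← integral_mul_const]
  exact integral_congr_ae (Eventually.of_forall fun ω => by ring)

end Model.IsTrajectory

end QLearning

/-! ### The response to the noise and its correlation with the noise -/

namespace QLearning

namespace Model

variable {S : Type u} {A : Type v} [Fintype S] [Fintype A] [DecidableEq S] [DecidableEq A]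

/-- The response of the lower comparison system to the noise alone, started from zero. -/
noncomputable def noiseSum (𝓜 : Model S A) (μ₀ : S × A → ℝ) (g : (S × A → ℝ) → S → A) (α : ℕ → ℝ)
    (Q₀ : S × A → ℝ) (z : ℕ → S × A) : ℕ → S × A → ℝ
  | 0 => 0
  | k + 1 => (1 + α k • 𝓜.T μ₀ (g 𝓜.QStar)) *ᵥ (𝓜.noiseSum μ₀ g α Q₀ z k)
      + α k • 𝓜.noiseAt μ₀ g α Q₀ z k

section Determined

variable (𝓜 : Model S A) (μ₀ : S × A → ℝ) (g : (S × A → ℝ) → S → A) (α : ℕ → ℝ)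
  (Q₀ QL₀ QU₀ : S × A → ℝ) {Ω : Type w} (Z : ℕ → Ω → S × A)

lemma determinedBy_Qiter (k : ℕ) :
    DeterminedBy Z k fun ω => 𝓜.Qiter α Q₀ (fun i => Z i ω) k := by
  induction k with
  | zero => exact fun _ _ _ => rfl
  | succ k ih =>
    intro ω ω' h
    have h1 := ih ω ω' fun i hi => h i (hi.trans (Nat.le_succ k))
    beta_reduce at h1
    simp only [Qiter]
    rw [h1, h k (Nat.le_succ k), h (k + 1) le_rfl]

/-- The index is `k + 1`, since `w_k` sees the next state `s_{k+1}`. The response at time `k`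
involves noise only up to `w_{k-1}`, hence only the history up to time `k`. -/
lemma determinedBy_noiseAt (k : ℕ) :
    DeterminedBy Z (k + 1) fun ω => 𝓜.noiseAt μ₀ g α Q₀ (fun i => Z i ω) k := by
  intro ω ω' h
  have h1 := determinedBy_Qiter 𝓜 α Q₀ Z k ω ω' fun i hi => h i (hi.trans (Nat.le_succ k))
  beta_reduce at h1
  simp only [noiseAt]
  rw [h1, h k (Nat.le_succ k), h (k + 1) le_rfl]

lemma determinedBy_noiseSum (k : ℕ) :
    DeterminedBy Z k fun ω => 𝓜.noiseSum μ₀ g α Q₀ (fun i => Z i ω) k := by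
  induction k with
  | zero => exact fun _ _ _ => rfl
  | succ k ih =>
    intro ω ω' h
    have h1 := ih ω ω' fun i hi => h i (hi.trans (Nat.le_succ k))
    have h2 := determinedBy_noiseAt 𝓜 μ₀ g α Q₀ Z k ω ω' h
    beta_reduce at h1 h2
    simp only [noiseSum]
    rw [h1, h2]

lemma determinedBy_QLower (k : ℕ) :
    DeterminedBy Z k fun ω => 𝓜.QLower μ₀ g α Q₀ QL₀ (fun i => Z i ω) k := by
  induction k with
  | zero => exact fun _ _ _ => rfl
  | succ k ih =>
    intro ω ω' h
    have h1 := ih ω ω' fun i hi => h i (hi.trans (Nat.le_succ k))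
    have h2 := determinedBy_noiseAt 𝓜 μ₀ g α Q₀ Z k ω ω' h
    beta_reduce at h1 h2
    simp only [QLower]
    rw [h1, h2]

lemma determinedBy_QUpper (k : ℕ) :
    DeterminedBy Z k fun ω => 𝓜.QUpper μ₀ g α Q₀ QU₀ (fun i => Z i ω) k := by
  induction k with
  | zero => exact fun _ _ _ => rfl
  | succ k ih =>
    intro ω ω' h
    have hk : ∀ i, i ≤ k → Z i ω = Z i ω' := fun i hi => h i (hi.trans (Nat.le_succ k))
    have h1 := ih ω ω' hk
    have h2 := determinedBy_Qiter 𝓜 α Q₀ Z k ω ω' hk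
    have h3 := determinedBy_noiseAt 𝓜 μ₀ g α Q₀ Z k ω ω' h
    beta_reduce at h1 h2 h3
    simp only [QUpper]
    rw [h1, h2, h3]

end Determined

variable {𝓜 : Model S A} {μ₀ : S × A → ℝ} [Nonempty S] [Nonempty A]
  {g : (S × A → ℝ) → S → A} {α : ℕ → ℝ} {Q₀ : S × A → ℝ}

/-- A uniform bound of the response to the noise. -/
noncomputable def noiseSumBound (𝓜 : Model S A) (μ₀ : S × A → ℝ) : ℝ :=
  4 * 𝓜.horizon / 𝓜.rate μ₀

namespace PosStationary

lemma noiseSumBound_nonneg (h : 𝓜.PosStationary μ₀) : 0 ≤ 𝓜.noiseSumBound μ₀ :=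
  div_nonneg (by linarith [𝓜.one_le_horizon]) h.rate_pos.le

lemma rate_mul_noiseSumBound (h : 𝓜.PosStationary μ₀) :
    𝓜.rate μ₀ * 𝓜.noiseSumBound μ₀ = 4 * 𝓜.horizon :=
  mul_div_cancel₀ _ h.rate_pos.ne'

lemma le_noiseSumBound (h : 𝓜.PosStationary μ₀) : 4 * 𝓜.horizon ≤ 𝓜.noiseSumBound μ₀ := by
  rw [← h.rate_mul_noiseSumBound]
  exact mul_le_of_le_one_left h.noiseSumBound_nonneg h.rate_le_one

/-- The bound `4 · horizon / κ` is the fixed point of `x ↦ (1 - κ a) x + a · 4 · horizon`. -/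
lemma norm_noiseSum_le (h : 𝓜.PosStationary μ₀) (hg : IsGreedy g) (hα : ∀ k, 0 ≤ α k)
    (hα' : ∀ k, α k ≤ 1) (hQ₀ : ‖Q₀‖ ≤ 1) (z : ℕ → S × A) (k : ℕ) :
    ‖𝓜.noiseSum μ₀ g α Q₀ z k‖ ≤ 𝓜.noiseSumBound μ₀ := by
  induction k with
  | zero => rw [noiseSum, norm_zero]; exact h.noiseSumBound_nonneg
  | succ k ih =>
    rw [noiseSum]
    refine (norm_add_le _ _).trans ?_
    have h1 := h.norm_one_add_smul_T_mulVec_le (g 𝓜.QStar) (hα k) (hα' k)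
      (𝓜.noiseSum μ₀ g α Q₀ z k)
    have h2 := mul_le_mul_of_nonneg_left ih (sub_nonneg.2 (h.rate_mul_le_one (hα k) (hα' k)))
    have h3 := mul_le_mul_of_nonneg_left (h.norm_noiseAt_le hg hα hα' hQ₀ z k) (hα k)
    rw [norm_smul, Real.norm_eq_abs, abs_of_nonneg (hα k)]
    rw [← h.rate_mul_noiseSumBound] at h3
    linarith

/-- The increment is `α_k (T N_k + w_k)`: the first term contributes twice the uniform bound because
`d_max ≤ 1`, the second at most once. -/
lemma norm_noiseSum_succ_sub_le (h : 𝓜.PosStationary μ₀) (hg : IsGreedy g) (hα : ∀ k, 0 ≤ α k)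
    (hα' : ∀ k, α k ≤ 1) (hQ₀ : ‖Q₀‖ ≤ 1) (z : ℕ → S × A) (k : ℕ) :
    ‖𝓜.noiseSum μ₀ g α Q₀ z (k + 1) - 𝓜.noiseSum μ₀ g α Q₀ z k‖
      ≤ 3 * 𝓜.noiseSumBound μ₀ * α k := by
  set N := 𝓜.noiseSum μ₀ g α Q₀ z k
  have e : 𝓜.noiseSum μ₀ g α Q₀ z (k + 1) - N
      = α k • (𝓜.T μ₀ (g 𝓜.QStar) *ᵥ N + 𝓜.noiseAt μ₀ g α Q₀ z k) := by
    rw [noiseSum, add_mulVec, one_mulVec, smul_mulVec, smul_add]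
    abel
  have h0 := h.noiseSumBound_nonneg
  have h1 : ‖𝓜.T μ₀ (g 𝓜.QStar) *ᵥ N‖ ≤ 2 * 𝓜.noiseSumBound μ₀ := by
    refine (h.norm_T_mulVec_le _ N).trans ?_
    have := h.dMax_le_one
    exact mul_le_mul (by linarith) (h.norm_noiseSum_le hg hα hα' hQ₀ z k) (norm_nonneg _)
      (by norm_num)
  have h2 := (h.norm_noiseAt_le hg hα hα' hQ₀ z k).trans h.le_noiseSumBound
  rw [e, norm_smul, Real.norm_eq_abs, abs_of_nonneg (hα k), mul_comm]
  refine mul_le_mul_of_nonneg_right ((norm_add_le _ _).trans ?_) (hα k)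
  linarith

end PosStationary

end Model

/-- The integral of a bounded function on a probability space. -/
lemma abs_integral_le_of_abs_le {Ω : Type w} [MeasurableSpace Ω] {ℙ : Measure Ω}
    [IsProbabilityMeasure ℙ] {f : Ω → ℝ} {B : ℝ} (h : ∀ ω, |f ω| ≤ B) : |∫ ω, f ω ∂ℙ| ≤ B := by
  simpa using norm_integral_le_of_norm_le_const (μ := ℙ) (f := f) (C := B)
    (Eventually.of_forall h)

namespace Model.IsTrajectory

variable {S : Type u} {A : Type v} [Fintype S] [Fintype A] [DecidableEq S] [DecidableEq A]
  [Nonempty S] [Nonempty A] {𝓜 : Model S A} {μ₀ : S × A → ℝ}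
  {g : (S × A → ℝ) → S → A} {α : ℕ → ℝ} {Q₀ : S × A → ℝ} {Ω : Type w} [MeasurableSpace Ω]
  {ℙ : Measure Ω} [IsProbabilityMeasure ℙ] {Z : ℕ → Ω → S × A}

/-- The correlation of the response with the noise frozen `h` steps earlier is controlled by
mixing. -/
lemma abs_integral_noiseSum_mul_frozen_le (hZ : 𝓜.IsTrajectory μ₀ ℙ Z) (hμ₀ : ∀ x, 0 ≤ μ₀ x)
    (hp : 𝓜.PosStationary μ₀) (hg : IsGreedy g) (hα : ∀ k, 0 ≤ α k) (hα' : ∀ k, α k ≤ 1)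
    (hQ₀ : ‖Q₀‖ ≤ 1) (i h : ℕ) {ε : ℝ}
    (hε : ∀ x, ∑ y, |(𝓜.chain ^ h) x y - 𝓜.muInf μ₀ y| ≤ 2 * ε) (x y : S × A) :
    |∫ ω, 𝓜.noiseSum μ₀ g α Q₀ (fun l => Z l ω) i y
        * 𝓜.noise μ₀ g (𝓜.Qiter α Q₀ (fun l => Z l ω) i) (Z (i + h) ω) (Z (i + h + 1) ω).1 x ∂ℙ|
      ≤ 𝓜.noiseSumBound μ₀ * (4 * 𝓜.horizon * ε) := by
  -- With `Q` frozen at time `i`, the integrand depends on the history up to `i` and on one later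
  -- transition only, which is the form needed for conditioning.
  have hd : DeterminedBy Z i fun ω (a b : S × A) => 𝓜.noiseSum μ₀ g α Q₀ (fun l => Z l ω) i y
      * 𝓜.noise μ₀ g (𝓜.Qiter α Q₀ (fun l => Z l ω) i) a b.1 x :=
    (determinedBy_noiseSum 𝓜 μ₀ g α Q₀ Z i).comp₂ (determinedBy_Qiter 𝓜 α Q₀ Z i)
      fun N Q (a b : S × A) => N y * 𝓜.noise μ₀ g Q a b.1 x
  rw [hZ.integral_transition hμ₀ hd h]
  refine abs_integral_le_of_abs_le fun ω => ?_
  have e : ∑ a, ∑ b, (𝓜.chain ^ h) (Z i ω) a * 𝓜.chain a b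
        * (𝓜.noiseSum μ₀ g α Q₀ (fun l => Z l ω) i y
          * 𝓜.noise μ₀ g (𝓜.Qiter α Q₀ (fun l => Z l ω) i) a b.1 x)
      = 𝓜.noiseSum μ₀ g α Q₀ (fun l => Z l ω) i y * ∑ a, ∑ b, (𝓜.chain ^ h) (Z i ω) a
        * 𝓜.chain a b * 𝓜.noise μ₀ g (𝓜.Qiter α Q₀ (fun l => Z l ω) i) a b.1 x := by
    simp only [Finset.mul_sum]
    exact Finset.sum_congr rfl fun a _ => Finset.sum_congr rfl fun b _ => by ring
  rw [e, abs_mul]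
  refine mul_le_mul ((abs_apply_le_norm _ y).trans (hp.norm_noiseSum_le hg hα hα' hQ₀ _ i)) ?_
    (abs_nonneg _) hp.noiseSumBound_nonneg
  refine (abs_sum_noise_le hg (norm_Qiter_le hα hα' hQ₀ _ i) _ (𝓜.chain_pow_sum h _) (hε _)
    x).trans_eq ?_
  ring

/-- The correlation of the response with the noise. -/
lemma abs_integral_noiseSum_mul_noiseAt_le (hZ : 𝓜.IsTrajectory μ₀ ℙ Z) (hμ₀ : ∀ x, 0 ≤ μ₀ x)
    (hp : 𝓜.PosStationary μ₀) (hg : IsGreedy g) (hα : ∀ k, 0 ≤ α k) (hα' : ∀ k, α k ≤ 1)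
    (hanti : Antitone α) (hQ₀ : ‖Q₀‖ ≤ 1) (i h : ℕ) {ε : ℝ}
    (hε : ∀ x, ∑ y, |(𝓜.chain ^ h) x y - 𝓜.muInf μ₀ y| ≤ 2 * ε) (x y : S × A) :
    |∫ ω, 𝓜.noiseSum μ₀ g α Q₀ (fun l => Z l ω) (i + h) y
        * 𝓜.noiseAt μ₀ g α Q₀ (fun l => Z l ω) (i + h) x ∂ℙ|
      ≤ 𝓜.noiseSumBound μ₀ * (4 * 𝓜.horizon) * (5 * (h * α i) + ε) := by
  have hL := 𝓜.one_le_horizon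
  have hM := hp.noiseSumBound_nonneg
  set F : Ω → ℝ := fun ω => 𝓜.noiseSum μ₀ g α Q₀ (fun l => Z l ω) i y
        * 𝓜.noise μ₀ g (𝓜.Qiter α Q₀ (fun l => Z l ω) i) (Z (i + h) ω) (Z (i + h + 1) ω).1 x
  set H : Ω → ℝ := fun ω => 𝓜.noiseSum μ₀ g α Q₀ (fun l => Z l ω) (i + h) y
        * 𝓜.noiseAt μ₀ g α Q₀ (fun l => Z l ω) (i + h) x
  have hF : Integrable F ℙ := by
    refine hZ.integrable_of_determinedBy (n := i + h + 1) ?_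
    have h1 := ((determinedBy_noiseSum 𝓜 μ₀ g α Q₀ Z i).comp₂ (determinedBy_Qiter 𝓜 α Q₀ Z i)
      fun N Q a b => N y * 𝓜.noise μ₀ g Q a b x).mono (show i ≤ i + h + 1 by omega)
    have h2 : DeterminedBy Z (i + h + 1) (Z (i + h)) := DeterminedBy.coord (by omega)
    have h3 : DeterminedBy Z (i + h + 1) (Z (i + h + 1)) := DeterminedBy.coord le_rfl
    exact (h1.comp₂ h2 fun f a => f a).comp₂ h3 fun f b => f b.1
  have hH : Integrable H ℙ :=
    hZ.integrable_of_determinedBy (n := i + h + 1)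
      (((determinedBy_noiseSum 𝓜 μ₀ g α Q₀ Z (i + h)).mono (Nat.le_succ _)).comp₂
        (determinedBy_noiseAt 𝓜 μ₀ g α Q₀ Z (i + h)) fun N W => N y * W x)
  have hdiff : ∀ ω, |H ω - F ω|
      ≤ 𝓜.noiseSumBound μ₀ * (4 * 𝓜.horizon) * (5 * (h * α i)) := by
    intro ω
    set z : ℕ → S × A := fun l => Z l ω
    -- The response and the iterate inside the noise are moved back to time `i` one after the other;
    -- the transition itself stays at time `i + h`.
    have e : H ω - F ω = (𝓜.noiseSum μ₀ g α Q₀ z (i + h) - 𝓜.noiseSum μ₀ g α Q₀ z i) y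
          * 𝓜.noiseAt μ₀ g α Q₀ z (i + h) x
        + 𝓜.noiseSum μ₀ g α Q₀ z i y * (𝓜.noise μ₀ g (𝓜.Qiter α Q₀ z (i + h)) (z (i + h))
            (z (i + h + 1)).1 - 𝓜.noise μ₀ g (𝓜.Qiter α Q₀ z i) (z (i + h))
            (z (i + h + 1)).1) x := by
      simp only [H, F, noiseAt, Pi.sub_apply]
      ring
    have h1 := (abs_apply_le_norm (𝓜.noiseSum μ₀ g α Q₀ z (i + h) - 𝓜.noiseSum μ₀ g α Q₀ z i)
      y).trans (norm_sub_le_of_norm_succ_sub_le _ hanti (by linarith)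
        (hp.norm_noiseSum_succ_sub_le hg hα hα' hQ₀ z) i h)
    have h2 := (abs_apply_le_norm _ x).trans (hp.norm_noiseAt_le hg hα hα' hQ₀ z (i + h))
    have h3 := (abs_apply_le_norm _ y).trans (hp.norm_noiseSum_le hg hα hα' hQ₀ z i)
    have h4 := norm_sub_le_of_norm_succ_sub_le (𝓜.Qiter α Q₀ z) hanti (by linarith)
        (norm_Qiter_succ_sub_le hα hα' hQ₀ z) i h
    have h5 := (abs_apply_le_norm _ x).trans (hp.norm_noise_sub_le hg (𝓜.Qiter α Q₀ z (i + h))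
      (𝓜.Qiter α Q₀ z i) (z (i + h)) (z (i + h + 1)).1)
    rw [e]
    have hhα : 0 ≤ h * α i := mul_nonneg (Nat.cast_nonneg h) (hα i)
    refine (abs_add_le _ _).trans ?_
    rw [abs_mul, abs_mul]
    -- The two errors contribute `3 · 4` and `4 · 2`; their sum is `20 = 4 · 5`.
    calc _ ≤ (3 * 𝓜.noiseSumBound μ₀ * (h * α i)) * (4 * 𝓜.horizon)
          + 𝓜.noiseSumBound μ₀ * (4 * (2 * 𝓜.horizon * (h * α i))) := by
          refine add_le_add (mul_le_mul h1 h2 (abs_nonneg _) (by positivity))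
            (mul_le_mul h3 (h5.trans (by linarith)) (abs_nonneg _) hM)
      _ = _ := by ring
  have h1 := hZ.abs_integral_noiseSum_mul_frozen_le hμ₀ hp hg hα hα' hQ₀ i h hε x y
  have h2 := abs_integral_le_of_abs_le (ℙ := ℙ) hdiff
  rw [integral_sub hH hF] at h2
  have h3 := abs_sub_abs_le_abs_sub (∫ ω, H ω ∂ℙ) (∫ ω, F ω ∂ℙ)
  have h4 : |∫ ω, F ω ∂ℙ| ≤ 𝓜.noiseSumBound μ₀ * (4 * 𝓜.horizon * ε) := h1
  linarith

/-- The correlation of the response with the noise, at early times. -/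
lemma abs_integral_noiseSum_mul_noiseAt_le_of_early
    (hp : 𝓜.PosStationary μ₀) (hg : IsGreedy g) (hα : ∀ k, 0 ≤ α k) (hα' : ∀ k, α k ≤ 1)
    (hanti : Antitone α) (hQ₀ : ‖Q₀‖ ≤ 1) (j : ℕ) (x y : S × A) :
    |∫ ω, 𝓜.noiseSum μ₀ g α Q₀ (fun l => Z l ω) j y
        * 𝓜.noiseAt μ₀ g α Q₀ (fun l => Z l ω) j x ∂ℙ|
      ≤ 𝓜.noiseSumBound μ₀ * (4 * 𝓜.horizon) * (3 * (j * α 0)) := by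
  have hM := hp.noiseSumBound_nonneg
  refine abs_integral_le_of_abs_le fun ω => ?_
  set z : ℕ → S × A := fun l => Z l ω
  -- The response starts from zero, so its value is its total increment.
  have h1 := norm_sub_le_of_norm_succ_sub_le _ hanti (by linarith)
        (hp.norm_noiseSum_succ_sub_le hg hα hα' hQ₀ z) 0 j
  rw [zero_add, noiseSum, sub_zero] at h1
  have h2 := (abs_apply_le_norm _ x).trans (hp.norm_noiseAt_le hg hα hα' hQ₀ z j)
  have h0 : 0 ≤ j * α 0 := mul_nonneg (Nat.cast_nonneg j) (hα 0)
  rw [abs_mul]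
  calc _ ≤ (3 * 𝓜.noiseSumBound μ₀ * (j * α 0)) * (4 * 𝓜.horizon) :=
        mul_le_mul ((abs_apply_le_norm _ y).trans h1) h2 (abs_nonneg _) (by positivity)
    _ = _ := by ring

/-- One step of the second-moment recursion. -/
lemma integral_noiseSum_succ_sq_le (hZ : 𝓜.IsTrajectory μ₀ ℙ Z)
    (hp : 𝓜.PosStationary μ₀) (hg : IsGreedy g) (hα : ∀ k, 0 ≤ α k) (hα' : ∀ k, α k ≤ 1)
    (hQ₀ : ‖Q₀‖ ≤ 1) (j : ℕ) {s q : ℝ}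
    (hs : ∀ y, ∫ ω, 𝓜.noiseSum μ₀ g α Q₀ (fun l => Z l ω) j y ^ 2 ∂ℙ ≤ s)
    (hq : ∀ x y, |∫ ω, 𝓜.noiseSum μ₀ g α Q₀ (fun l => Z l ω) j y
        * 𝓜.noiseAt μ₀ g α Q₀ (fun l => Z l ω) j x ∂ℙ| ≤ q) (x : S × A) :
    ∫ ω, 𝓜.noiseSum μ₀ g α Q₀ (fun l => Z l ω) (j + 1) x ^ 2 ∂ℙ
      ≤ (1 - 𝓜.rate μ₀ * α j) * s + 2 * α j * q + α j ^ 2 * (4 * 𝓜.horizon) ^ 2 := by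
  set N : Ω → S × A → ℝ := fun ω => 𝓜.noiseSum μ₀ g α Q₀ (fun l => Z l ω) j
  set W : Ω → S × A → ℝ := fun ω => 𝓜.noiseAt μ₀ g α Q₀ (fun l => Z l ω) j
  set M := 1 + α j • 𝓜.T μ₀ (g 𝓜.QStar)
  have hMx : ∑ y, |M x y| ≤ 1 - 𝓜.rate μ₀ * α j :=
    hp.sum_abs_one_add_smul_T_le (g 𝓜.QStar) (hα j) (hα' j) x
  have hrα : 0 ≤ 𝓜.rate μ₀ * α j := mul_nonneg hp.rate_pos.le (hα j)
  have hM1 : ∑ y, |M x y| ≤ 1 := by linarith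
  have hM0 : 0 ≤ ∑ y, |M x y| := Finset.sum_nonneg fun y _ => abs_nonneg _
  have hdN : DeterminedBy Z (j + 1) N :=
    (determinedBy_noiseSum 𝓜 μ₀ g α Q₀ Z j).mono (Nat.le_succ j)
  have hdW : DeterminedBy Z (j + 1) W := determinedBy_noiseAt 𝓜 μ₀ g α Q₀ Z j
  have hiN : ∀ y, Integrable (fun ω => N ω y ^ 2) ℙ := fun y =>
    hZ.integrable_of_determinedBy (hdN.comp fun N => N y ^ 2)
  have hiNW : ∀ y, Integrable (fun ω => N ω y * W ω x) ℙ := fun y =>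
    hZ.integrable_of_determinedBy (hdN.comp₂ hdW fun N W => N y * W x)
  have hs0 : 0 ≤ s := (integral_nonneg fun ω => sq_nonneg _).trans (hs x)
  have hq0 : 0 ≤ q := (abs_nonneg _).trans (hq x x)
  have hpt : ∀ ω, 𝓜.noiseSum μ₀ g α Q₀ (fun l => Z l ω) (j + 1) x ^ 2
      ≤ ∑ y, |M x y| * N ω y ^ 2 + 2 * α j * ∑ y, M x y * (N ω y * W ω x)
        + α j ^ 2 * (4 * 𝓜.horizon) ^ 2 := by
    intro ω
    have e : 𝓜.noiseSum μ₀ g α Q₀ (fun l => Z l ω) (j + 1) x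
        = ∑ y, M x y * N ω y + α j * W ω x := rfl
    -- Cauchy–Schwarz with weights `|M x y|` of total mass at most one. The contraction factor is
    -- kept once, in the weights, and acts on the largest second moment over coordinates.
    have h1 : (∑ y, M x y * N ω y) ^ 2 ≤ ∑ y, |M x y| * N ω y ^ 2 := by
      have hn : 0 ≤ ∑ y, |M x y| * N ω y ^ 2 :=
        Finset.sum_nonneg fun y _ => mul_nonneg (abs_nonneg _) (sq_nonneg _)
      refine (Finset.sum_sq_le_sum_mul_sum_of_sq_le_mul Finset.univ (f := fun y => |M x y|)
        (g := fun y => |M x y| * N ω y ^ 2) (fun y _ => abs_nonneg _)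
        (fun y _ => mul_nonneg (abs_nonneg _) (sq_nonneg _)) fun y _ => ?_).trans
          (mul_le_of_le_one_left hn hM1)
      rw [mul_pow, ← mul_assoc, ← sq, sq_abs]
    have h2 : (∑ y, M x y * N ω y) * W ω x = ∑ y, M x y * (N ω y * W ω x) := by
      rw [Finset.sum_mul]
      exact Finset.sum_congr rfl fun y _ => mul_assoc _ _ _
    have h3 : W ω x ^ 2 ≤ (4 * 𝓜.horizon) ^ 2 := by
      rw [← sq_abs]
      exact pow_le_pow_left₀ (abs_nonneg _) ((abs_apply_le_norm _ x).trans
        (hp.norm_noiseAt_le hg hα hα' hQ₀ _ j)) 2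
    have h4 := mul_le_mul_of_nonneg_left h3 (sq_nonneg (α j))
    rw [e, ← h2]
    linarith [add_sq (∑ y, M x y * N ω y) (α j * W ω x)]
  have hi1 : Integrable (fun ω => ∑ y, |M x y| * N ω y ^ 2) ℙ :=
    integrable_finsetSum _ fun y _ => (hiN y).const_mul _
  have hi2 : Integrable (fun ω => 2 * α j * ∑ y, M x y * (N ω y * W ω x)) ℙ :=
    (integrable_finsetSum _ fun y _ => (hiNW y).const_mul _).const_mul _
  have hi0 : Integrable (fun ω => 𝓜.noiseSum μ₀ g α Q₀ (fun l => Z l ω) (j + 1) x ^ 2) ℙ :=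
    hZ.integrable_of_determinedBy
      ((determinedBy_noiseSum 𝓜 μ₀ g α Q₀ Z (j + 1)).comp fun N => N x ^ 2)
  refine (integral_mono hi0 ((hi1.add hi2).add (integrable_const _)) hpt).trans ?_
  have h1 : ∫ ω, ∑ y, |M x y| * N ω y ^ 2 ∂ℙ ≤ (1 - 𝓜.rate μ₀ * α j) * s := by
    rw [integral_finsetSum _ fun y _ => (hiN y).const_mul _]
    calc _ ≤ ∑ y, |M x y| * s := Finset.sum_le_sum fun y _ => by
          rw [integral_const_mul]
          exact mul_le_mul_of_nonneg_left (hs y) (abs_nonneg _)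
      _ ≤ _ := by rw [← Finset.sum_mul]; gcongr
  have h2 : ∫ ω, ∑ y, M x y * (N ω y * W ω x) ∂ℙ ≤ q := by
    rw [integral_finsetSum _ fun y _ => (hiNW y).const_mul _]
    calc _ ≤ ∑ y, |M x y| * q := Finset.sum_le_sum fun y _ => by
          rw [integral_const_mul]
          refine (le_abs_self _).trans ?_
          rw [abs_mul]
          exact mul_le_mul_of_nonneg_left (hq x y) (abs_nonneg _)
      _ ≤ q := by rw [← Finset.sum_mul]; exact mul_le_of_le_one_left hq0 hM1
  have h3 := mul_le_mul_of_nonneg_left h2 (mul_nonneg zero_le_two (hα j))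
  rw [integral_add' (hi1.add hi2) (integrable_const _), integral_add' hi1 hi2, integral_const_mul,
    integral_const, probReal_univ, one_smul]
  linarith

end Model.IsTrajectory

end QLearning

/-! ### Step-size recursions and moments of the response -/

namespace QLearning

section StepSize

variable {θ ξ : ℝ}

lemma stepSize_nonneg (hθ : 0 ≤ θ) (hξ : 0 ≤ ξ) (k : ℕ) : 0 ≤ stepSize θ ξ k := by
  rw [stepSize]; positivity

lemma stepSize_pos (hθ : 0 < θ) (hξ : 0 < ξ) (k : ℕ) : 0 < stepSize θ ξ k := by
  rw [stepSize]; positivity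

lemma stepSize_le_one (hξ : 0 < ξ) (hθξ : θ ≤ ξ) (k : ℕ) : stepSize θ ξ k ≤ 1 := by
  rw [stepSize, div_le_one (by positivity)]
  have : (0 : ℝ) ≤ k := Nat.cast_nonneg k
  linarith

lemma stepSize_antitone (hθ : 0 ≤ θ) (hξ : 0 < ξ) : Antitone (stepSize θ ξ) := by
  intro i j hij
  have : (i : ℝ) ≤ j := Nat.cast_le.2 hij
  rw [stepSize, stepSize]
  gcongr

/-- The first time the mixing bound falls below a positive level is attained. -/
lemma mul_pow_tauMix_le {m ρ c : ℝ} (hρ : 0 ≤ ρ) (hρ' : ρ < 1) (hc : 0 < c) :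
    m * ρ ^ tauMix m ρ c ≤ c := by
  have h0 : Tendsto (fun k : ℕ => m * ρ ^ k) atTop (𝓝 0) := by
    simpa using (tendsto_pow_atTop_nhds_zero_of_lt_one hρ hρ').const_mul m
  obtain ⟨k, hk⟩ := (h0.eventually_lt_const hc).exists
  exact Nat.sInf_mem (s := {k : ℕ | m * ρ ^ k ≤ c}) ⟨k, hk.le⟩

/-- A recursion with contraction rate at least `2 / t` preserves a bound of order `1 / √t`. -/
lemma sqrt_recursion_step {κ t b U : ℝ} (ht : 2 ≤ t) (hκθ : 2 ≤ κ * θ) (hU : 0 ≤ U)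
    (hb : 2 * b ≤ κ * U) (hθ : 0 ≤ θ) :
    (1 - κ * (θ / t)) * (U / √t) + θ / t * (b / √t) ≤ U / √(t + 1) := by
  have ht0 : 0 < t := by linarith
  have hs : 0 < √t := Real.sqrt_pos.2 ht0
  have hs' : 0 < √(t + 1) := Real.sqrt_pos.2 (by linarith)
  -- A loss of `1 / t` per step suffices for decay of order `1 / √t`. The rate `2 / t` supplies
  -- twice that, and `hb` spends half of it on the forcing.
  have h1 : (1 - 1 / t) * √(t + 1) ≤ √t := by
    have h0 : 0 ≤ 1 - 1 / t := by
      rw [sub_nonneg, div_le_one ht0]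
      linarith
    refine abs_le_of_sq_le_sq' ?_ hs.le |>.2
    rw [mul_pow, Real.sq_sqrt (by linarith), Real.sq_sqrt ht0.le]
    have e : (1 - 1 / t) ^ 2 * (t + 1) = (t ^ 3 - t ^ 2 - t + 1) / t ^ 2 := by
      field_simp
      ring
    rw [e, div_le_iff₀ (by positivity)]
    nlinarith
  calc (1 - κ * (θ / t)) * (U / √t) + θ / t * (b / √t)
      = (U - (κ * θ * U - θ * b) / t) / √t := by field_simp; ring
    _ ≤ (U - U / t) / √t := by
      gcongr
      have h2 := mul_le_mul_of_nonneg_left hb hθ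
      have h3 := mul_le_mul_of_nonneg_right hκθ hU
      linarith
    _ = U * (1 - 1 / t) / √t := by ring
    _ ≤ U / √(t + 1) := by
      rw [div_le_div_iff₀ hs hs', mul_assoc]
      exact mul_le_mul_of_nonneg_left h1 hU

/-- A recursion with contraction rate at least `2 / t` preserves a bound of order `1 / t`. -/
lemma second_moment_recursion_step {κ t B l : ℝ} (ht : 0 < t) (hκ : 0 < κ) (hκ' : κ ≤ 1)
    (hκθ : 2 ≤ κ * θ) (hθ : 0 ≤ θ) (hl : 0 ≤ l) :
    (1 - κ * (θ / t)) * (42 * (l + 1) * B ^ 2 * θ / t)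
        + 2 * (θ / t) * (B * (κ * B) * (10 * (l + 1) * (θ / t))) + (θ / t) ^ 2 * (κ * B) ^ 2
      ≤ 42 * (l + 1) * B ^ 2 * θ / (t + 1) := by
  -- The sources amount to `20 + 1 = 21` units of `κ B² (l + 1) (θ / t)²`. With `42 = 2 · 21` they
  -- use exactly half of the contraction; the other half is at least `M / t²`, as `κ θ ≥ 2`.
  set M := 42 * (l + 1) * B ^ 2 * θ with hM
  have hM0 : 0 ≤ M := by positivity
  have h1 : (θ / t) ^ 2 * (κ * B) ^ 2 ≤ κ * B ^ 2 * (θ / t) ^ 2 * (l + 1) := by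
    have hk : κ ^ 2 ≤ κ * (l + 1) := by nlinarith
    calc _ = κ ^ 2 * (B ^ 2 * (θ / t) ^ 2) := by ring
      _ ≤ κ * (l + 1) * (B ^ 2 * (θ / t) ^ 2) := by gcongr
      _ = _ := by ring
  have h2 : 1 / t ^ 2 * M ≤ κ * θ / 2 / t ^ 2 * M := by
    gcongr
    linarith
  calc _ ≤ (1 - κ * (θ / t)) * (M / t)
        + 2 * (θ / t) * (B * (κ * B) * (10 * (l + 1) * (θ / t)))
        + κ * B ^ 2 * (θ / t) ^ 2 * (l + 1) := by gcongr
    _ = M / t - κ * θ / 2 / t ^ 2 * M := by rw [hM]; field_simp; ring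
    _ ≤ M / t - 1 / t ^ 2 * M := by linarith
    _ = M * ((t - 1) / t ^ 2) := by field_simp
    _ ≤ M * (1 / (t + 1)) := by
      refine mul_le_mul_of_nonneg_left ?_ hM0
      rw [div_le_div_iff₀ (by positivity) (by positivity)]
      nlinarith
    _ = _ := by ring

end StepSize

/-- Nonnegativity of the variance. -/
lemma sq_integral_le_integral_sq {Ω : Type w} [MeasurableSpace Ω] {ℙ : Measure Ω}
    [IsProbabilityMeasure ℙ] {f : Ω → ℝ} (hf : Integrable f ℙ)
    (hf2 : Integrable (fun ω => f ω ^ 2) ℙ) : (∫ ω, f ω ∂ℙ) ^ 2 ≤ ∫ ω, f ω ^ 2 ∂ℙ := by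
  set a := ∫ ω, f ω ∂ℙ with ha
  have h0 : 0 ≤ ∫ ω, (f ω - a) ^ 2 ∂ℙ := integral_nonneg fun ω => sq_nonneg _
  have e : ∀ ω, (f ω - a) ^ 2 = f ω ^ 2 - 2 * a * f ω + a ^ 2 := fun ω => by ring
  simp only [e] at h0
  rw [integral_add (f := fun ω => f ω ^ 2 - 2 * a * f ω) (hf2.sub (hf.const_mul _))
      (integrable_const _),
    integral_sub hf2 (hf.const_mul _), integral_const_mul, integral_const, probReal_univ,
    one_smul, ← ha] at h0
  linarith

namespace Model.IsTrajectory

variable {S : Type u} {A : Type v} [Fintype S] [Fintype A] [DecidableEq S] [DecidableEq A]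
  [Nonempty S] [Nonempty A] {𝓜 : Model S A} {μ₀ : S × A → ℝ}
  {g : (S × A → ℝ) → S → A} {θ ξ : ℝ} {Q₀ QL₀ QU₀ : S × A → ℝ} {Ω : Type w} [MeasurableSpace Ω]
  {ℙ : Measure Ω} [IsProbabilityMeasure ℙ] {Z : ℕ → Ω → S × A}

/-- Second moment of the response to the noise, when the chain mixes up to the step-size within
`l` steps. -/
lemma integral_noiseSum_sq_le (hZ : 𝓜.IsTrajectory μ₀ ℙ Z) (hμ₀ : ∀ x, 0 ≤ μ₀ x)
    (hp : 𝓜.PosStationary μ₀) (hg : IsGreedy g) (hθ : 2 ≤ 𝓜.rate μ₀ * θ) (hθ2 : 2 ≤ θ)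
    (hθξ : θ ≤ ξ) (hQ₀ : ‖Q₀‖ ≤ 1) {l k : ℕ}
    (hε : ∀ x, ∑ y, |(𝓜.chain ^ l) x y - 𝓜.muInf μ₀ y| ≤ 2 * stepSize θ ξ k)
    (j : ℕ) (hj : j ≤ k) (x : S × A) :
    ∫ ω, 𝓜.noiseSum μ₀ g (stepSize θ ξ) Q₀ (fun i => Z i ω) j x ^ 2 ∂ℙ
      ≤ 42 * (l + 1) * 𝓜.noiseSumBound μ₀ ^ 2 * θ / (j + ξ) := by
  have hξ0 : 0 < ξ := by linarith
  have hα := stepSize_nonneg (θ := θ) (ξ := ξ) (by linarith) hξ0.le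
  have hα' := stepSize_le_one hξ0 hθξ
  have hanti := stepSize_antitone (θ := θ) (ξ := ξ) (by linarith) hξ0
  have hB := hp.noiseSumBound_nonneg
  have hW := hp.rate_mul_noiseSumBound
  have hl : (0 : ℝ) ≤ l := Nat.cast_nonneg l
  induction j generalizing x with
  | zero =>
    simp only [noiseSum, Pi.zero_apply, ne_eq, OfNat.ofNat_ne_zero, not_false_eq_true, zero_pow,
      integral_zero]
    positivity
  | succ j ih =>
    have hjk : j ≤ k := (Nat.le_succ j).trans hj
    have hj0 : (0 : ℝ) ≤ j := Nat.cast_nonneg j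
    push_cast
    -- While `j + ξ ≤ 4 l` the claim is weaker than the uniform bound. Afterwards, going back `l`
    -- steps, or to time zero if that comes first, at most doubles the step-size.
    rcases le_or_gt ((j : ℝ) + ξ) (4 * l) with hearly | hlate
    · have h1 : ∫ ω, 𝓜.noiseSum μ₀ g (stepSize θ ξ) Q₀ (fun i => Z i ω) (j + 1) x ^ 2 ∂ℙ
          ≤ 𝓜.noiseSumBound μ₀ ^ 2 := by
        refine (le_abs_self _).trans (abs_integral_le_of_abs_le fun ω => ?_)
        rw [abs_pow]
        exact pow_le_pow_left₀ (abs_nonneg _) ((abs_apply_le_norm _ x).trans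
          (hp.norm_noiseSum_le hg hα hα' hQ₀ _ _)) 2
      refine h1.trans ?_
      rw [le_div_iff₀ (by positivity)]
      calc 𝓜.noiseSumBound μ₀ ^ 2 * ((j : ℝ) + 1 + ξ)
          ≤ 𝓜.noiseSumBound μ₀ ^ 2 * (42 * (l + 1) * θ) := by gcongr; nlinarith
        _ = _ := by ring
    · have ht : 0 < (j : ℝ) + ξ := by positivity
      have hq : ∀ x y, |∫ ω, 𝓜.noiseSum μ₀ g (stepSize θ ξ) Q₀ (fun i => Z i ω) j y
          * 𝓜.noiseAt μ₀ g (stepSize θ ξ) Q₀ (fun i => Z i ω) j x ∂ℙ|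
          ≤ 𝓜.noiseSumBound μ₀ * (4 * 𝓜.horizon) * (10 * (l + 1) * stepSize θ ξ j) := by
        intro x y
        have hc : 0 ≤ 𝓜.noiseSumBound μ₀ * (4 * 𝓜.horizon) := by
          have := 𝓜.one_le_horizon
          positivity
        have hlag : ∀ i : ℕ, (j : ℝ) + ξ ≤ 2 * (i + ξ) →
            stepSize θ ξ i ≤ 2 * stepSize θ ξ j := by
          intro i hi
          rw [stepSize, stepSize, ← mul_div_assoc, div_le_div_iff₀ (by positivity) ht]
          calc θ * (j + ξ) ≤ θ * (2 * (i + ξ)) := by gcongr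
            _ = _ := by ring
        rcases le_total l j with hlj | hjl
        · obtain ⟨i, rfl⟩ := Nat.exists_eq_add_of_le' hlj
          have h1 := hZ.abs_integral_noiseSum_mul_noiseAt_le hμ₀ hp hg hα hα' hanti hQ₀ i l hε x y
          refine h1.trans (mul_le_mul_of_nonneg_left ?_ hc)
          -- The lag costs `5 l α_i ≤ 10 l α_j`, and the mixing error `α_k ≤ α_j` is absorbed in the
          -- `+ 1` of `10 (l + 1)`.
          have h2 := hlag i (by push_cast at hlate ⊢; linarith)
          have h3 := mul_le_mul_of_nonneg_left h2 hl
          have h4 := hanti hjk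
          have h5 := hα (i + l)
          linarith
        · have hjl' : (j : ℝ) ≤ l := Nat.cast_le.2 hjl
          refine (abs_integral_noiseSum_mul_noiseAt_le_of_early hp hg hα hα' hanti hQ₀ j x
            y).trans (mul_le_mul_of_nonneg_left ?_ hc)
          have h2 := hlag 0 (by push_cast; linarith)
          have h3 := mul_le_mul hjl' h2 (hα 0) hl
          have h5 := hα j
          have h6 := mul_nonneg hl h5
          linarith
      refine (hZ.integral_noiseSum_succ_sq_le hp hg hα hα' hQ₀ j (ih hjk) hq x).trans ?_
      rw [← hW]
      have := second_moment_recursion_step (θ := θ) (B := 𝓜.noiseSumBound μ₀) ht hp.rate_pos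
        hp.rate_le_one hθ (by linarith) hl
      rw [add_right_comm (j : ℝ) 1 ξ]
      exact this

/-- First moment of the response to the noise. -/
lemma integral_norm_noiseSum_le (hZ : 𝓜.IsTrajectory μ₀ ℙ Z) (hμ₀ : ∀ x, 0 ≤ μ₀ x)
    (hp : 𝓜.PosStationary μ₀) (hg : IsGreedy g) (hθ : 2 ≤ 𝓜.rate μ₀ * θ) (hθ2 : 2 ≤ θ)
    (hθξ : θ ≤ ξ) (hQ₀ : ‖Q₀‖ ≤ 1) {l k : ℕ}
    (hε : ∀ x, ∑ y, |(𝓜.chain ^ l) x y - 𝓜.muInf μ₀ y| ≤ 2 * stepSize θ ξ k)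
    (j : ℕ) (hj : j ≤ k) :
    ∫ ω, ‖𝓜.noiseSum μ₀ g (stepSize θ ξ) Q₀ (fun i => Z i ω) j‖ ∂ℙ
      ≤ √(Fintype.card S * Fintype.card A
          * (42 * (l + 1) * 𝓜.noiseSumBound μ₀ ^ 2 * θ)) / √(j + ξ) := by
  have hξ0 : 0 < ξ := by linarith
  have hd := determinedBy_noiseSum 𝓜 μ₀ g (stepSize θ ξ) Q₀ Z j
  -- Jensen, then the sup-norm is bounded by the Euclidean norm; summing over coordinates costs the
  -- factor `|S||A|`.
  rw [← Real.sqrt_div' _ (by positivity)]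
  refine Real.le_sqrt_of_sq_le ((sq_integral_le_integral_sq
    (hZ.integrable_of_determinedBy (hd.comp fun N => ‖N‖))
    (hZ.integrable_of_determinedBy (hd.comp fun N => ‖N‖ ^ 2))).trans ?_)
  have hi : ∀ x, Integrable
      (fun ω => 𝓜.noiseSum μ₀ g (stepSize θ ξ) Q₀ (fun i => Z i ω) j x ^ 2) ℙ := fun x =>
    hZ.integrable_of_determinedBy (hd.comp fun N => N x ^ 2)
  have h1 : ∀ ω, ‖𝓜.noiseSum μ₀ g (stepSize θ ξ) Q₀ (fun i => Z i ω) j‖ ^ 2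
      ≤ ∑ x, 𝓜.noiseSum μ₀ g (stepSize θ ξ) Q₀ (fun i => Z i ω) j x ^ 2 := by
    intro ω
    refine (pow_le_pow_left₀ (norm_nonneg _) (norm_le_norm2 _) 2).trans_eq ?_
    rw [norm2, EuclideanSpace.real_norm_sq_eq]
  refine (integral_mono (hZ.integrable_of_determinedBy (hd.comp fun N => ‖N‖ ^ 2))
    (integrable_finsetSum _ fun x _ => hi x) h1).trans ?_
  rw [integral_finsetSum _ fun x _ => hi x]
  refine (Finset.sum_le_sum fun x _ => hZ.integral_noiseSum_sq_le hμ₀ hp hg hθ hθ2 hθξ hQ₀ hε j hj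
    x).trans_eq ?_
  rw [Finset.sum_const, Finset.card_univ, nsmul_eq_mul, Fintype.card_prod, Nat.cast_mul]
  ring

end Model.IsTrajectory

/-! ### The lower comparison system and the gap -/

namespace Model

variable {S : Type u} {A : Type v} [Fintype S] [Fintype A] [DecidableEq S] [DecidableEq A]
  [Nonempty S] [Nonempty A] {𝓜 : Model S A} {μ₀ : S × A → ℝ}
  {g : (S × A → ℝ) → S → A} {θ ξ : ℝ} {Q₀ QL₀ QU₀ : S × A → ℝ}

/-- The lower comparison system forgets its initial value. -/
lemma PosStationary.norm_QLower_sub_sub_noiseSum_le (hp : 𝓜.PosStationary μ₀)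
    (hθ : 2 ≤ 𝓜.rate μ₀ * θ) (hθ2 : 2 ≤ θ) (hθξ : θ ≤ ξ) (z : ℕ → S × A) (j : ℕ) :
    ‖𝓜.QLower μ₀ g (stepSize θ ξ) Q₀ QL₀ z j - 𝓜.QStar - 𝓜.noiseSum μ₀ g (stepSize θ ξ) Q₀ z j‖
      ≤ √ξ * ‖QL₀ - 𝓜.QStar‖ / √(j + ξ) := by
  have hξ0 : 0 < ξ := by linarith
  have hα := stepSize_nonneg (θ := θ) (ξ := ξ) (by linarith) hξ0.le
  have hα' := stepSize_le_one hξ0 hθξ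
  induction j with
  | zero =>
    rw [QLower, noiseSum, sub_zero, Nat.cast_zero, zero_add,
      mul_div_cancel_left₀ _ (Real.sqrt_pos.2 hξ0).ne']
  | succ j ih =>
    -- Subtracting the response leaves the homogeneous recursion, so the step lemma applies with
    -- zero forcing.
    have e : 𝓜.QLower μ₀ g (stepSize θ ξ) Q₀ QL₀ z (j + 1) - 𝓜.QStar
        - 𝓜.noiseSum μ₀ g (stepSize θ ξ) Q₀ z (j + 1)
        = (1 + stepSize θ ξ j • 𝓜.T μ₀ (g 𝓜.QStar)) *ᵥ
          (𝓜.QLower μ₀ g (stepSize θ ξ) Q₀ QL₀ z j - 𝓜.QStar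
            - 𝓜.noiseSum μ₀ g (stepSize θ ξ) Q₀ z j) := by
      rw [mulVec_sub, QLower, noiseSum]
      abel
    have hj0 : (0 : ℝ) ≤ j := Nat.cast_nonneg j
    rw [e]
    refine (hp.norm_one_add_smul_T_mulVec_le _ (hα j) (hα' j) _).trans ?_
    refine (mul_le_mul_of_nonneg_left ih
      (sub_nonneg.2 (hp.rate_mul_le_one (hα j) (hα' j)))).trans ?_
    have h1 := sqrt_recursion_step (θ := θ) (t := j + ξ) (b := 0) (U := √ξ * ‖QL₀ - 𝓜.QStar‖)
      (by linarith) hθ (by positivity)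
      (by have := hp.rate_pos; simp only [mul_zero]; positivity) (by linarith)
    rw [zero_div, mul_zero, add_zero] at h1
    push_cast
    rw [add_right_comm]
    exact h1

/-- One step of the gap between the comparison systems. -/
lemma PosStationary.norm_gap_succ_le (hp : 𝓜.PosStationary μ₀) {α : ℕ → ℝ}
    (hα : ∀ k, 0 ≤ α k) (hα' : ∀ k, α k ≤ 1) (z : ℕ → S × A) (j : ℕ) :
    ‖𝓜.QUpper μ₀ g α Q₀ QU₀ z (j + 1) - 𝓜.QLower μ₀ g α Q₀ QL₀ z (j + 1)‖
      ≤ (1 - 𝓜.rate μ₀ * α j) * ‖𝓜.QUpper μ₀ g α Q₀ QU₀ z j - 𝓜.QLower μ₀ g α Q₀ QL₀ z j‖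
        + α j * (2 * 𝓜.dMax μ₀ * ‖𝓜.QLower μ₀ g α Q₀ QL₀ z j - 𝓜.QStar‖) := by
  set U := 𝓜.QUpper μ₀ g α Q₀ QU₀ z j
  set W := 𝓜.QLower μ₀ g α Q₀ QL₀ z j
  set π := g (𝓜.Qiter α Q₀ z j)
  -- The noise cancels; the only forcing comes from the two policies acting on the error of the
  -- lower system.
  have e : 𝓜.QUpper μ₀ g α Q₀ QU₀ z (j + 1) - 𝓜.QLower μ₀ g α Q₀ QL₀ z (j + 1)
      = (1 + α j • 𝓜.T μ₀ π) *ᵥ (U - W)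
        + α j • (𝓜.T μ₀ π *ᵥ (W - 𝓜.QStar) - 𝓜.T μ₀ (g 𝓜.QStar) *ᵥ (W - 𝓜.QStar)) := by
    rw [QUpper, QLower, ← sub_sub_sub_cancel_right U W 𝓜.QStar]
    simp only [add_mulVec, one_mulVec, smul_mulVec, mulVec_sub, smul_sub]
    abel
  rw [e]
  refine (norm_add_le _ _).trans (add_le_add
    (hp.norm_one_add_smul_T_mulVec_le _ (hα j) (hα' j) _) ?_)
  rw [norm_smul, Real.norm_eq_abs, abs_of_nonneg (hα j)]
  exact mul_le_mul_of_nonneg_left (hp.norm_T_sub_T_mulVec_le _ _ _) (hα j)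

namespace IsTrajectory

variable {Ω : Type w} [MeasurableSpace Ω]
  {ℙ : Measure Ω} [IsProbabilityMeasure ℙ] {Z : ℕ → Ω → S × A}

omit [Nonempty S] [Nonempty A] in
lemma integrable_gap (hZ : 𝓜.IsTrajectory μ₀ ℙ Z) (α : ℕ → ℝ) (k : ℕ) :
    Integrable (fun ω => ‖𝓜.QUpper μ₀ g α Q₀ QU₀ (fun i => Z i ω) k
      - 𝓜.QLower μ₀ g α Q₀ QL₀ (fun i => Z i ω) k‖) ℙ :=
  hZ.integrable_of_determinedBy ((determinedBy_QUpper 𝓜 μ₀ g α Q₀ QU₀ Z k).comp₂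
    (determinedBy_QLower 𝓜 μ₀ g α Q₀ QL₀ Z k) fun U W => ‖U - W‖)

/-- Mean error of the lower comparison system. -/
lemma integral_norm_QLower_sub_le (hZ : 𝓜.IsTrajectory μ₀ ℙ Z) (hμ₀ : ∀ x, 0 ≤ μ₀ x)
    (hp : 𝓜.PosStationary μ₀) (hg : IsGreedy g) (hθ : 2 ≤ 𝓜.rate μ₀ * θ) (hθ2 : 2 ≤ θ)
    (hθξ : θ ≤ ξ) (hQ₀ : ‖Q₀‖ ≤ 1) {l k : ℕ}
    (hε : ∀ x, ∑ y, |(𝓜.chain ^ l) x y - 𝓜.muInf μ₀ y| ≤ 2 * stepSize θ ξ k)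
    (j : ℕ) (hj : j ≤ k) :
    ∫ ω, ‖𝓜.QLower μ₀ g (stepSize θ ξ) Q₀ QL₀ (fun i => Z i ω) j - 𝓜.QStar‖ ∂ℙ
      ≤ (√ξ * ‖QL₀ - 𝓜.QStar‖ + √(Fintype.card S * Fintype.card A
          * (42 * (l + 1) * 𝓜.noiseSumBound μ₀ ^ 2 * θ))) / √(j + ξ) := by
  have hiL : Integrable (fun ω => ‖𝓜.QLower μ₀ g (stepSize θ ξ) Q₀ QL₀ (fun i => Z i ω) j
      - 𝓜.QStar‖) ℙ := hZ.integrable_of_determinedBy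
    ((determinedBy_QLower 𝓜 μ₀ g (stepSize θ ξ) Q₀ QL₀ Z j).comp fun W => ‖W - 𝓜.QStar‖)
  have hiN : Integrable (fun ω => ‖𝓜.noiseSum μ₀ g (stepSize θ ξ) Q₀ (fun i => Z i ω) j‖) ℙ :=
    hZ.integrable_of_determinedBy
      ((determinedBy_noiseSum 𝓜 μ₀ g (stepSize θ ξ) Q₀ Z j).comp fun N => ‖N‖)
  have hpt : ∀ ω, ‖𝓜.QLower μ₀ g (stepSize θ ξ) Q₀ QL₀ (fun i => Z i ω) j - 𝓜.QStar‖
      ≤ √ξ * ‖QL₀ - 𝓜.QStar‖ / √(j + ξ)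
        + ‖𝓜.noiseSum μ₀ g (stepSize θ ξ) Q₀ (fun i => Z i ω) j‖ := fun ω =>
    (norm_le_norm_sub_add _ _).trans (add_le_add_left
      (hp.norm_QLower_sub_sub_noiseSum_le hθ hθ2 hθξ _ j) _)
  refine (integral_mono hiL ((integrable_const _).add hiN) hpt).trans ?_
  rw [integral_add' (integrable_const _) hiN, integral_const, probReal_univ, one_smul, add_div]
  exact add_le_add_right (hZ.integral_norm_noiseSum_le hμ₀ hp hg hθ hθ2 hθξ hQ₀ hε j hj) _

/-- Mean gap between the comparison systems. -/
lemma integral_norm_gap_le (hZ : 𝓜.IsTrajectory μ₀ ℙ Z) (hμ₀ : ∀ x, 0 ≤ μ₀ x)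
    (hp : 𝓜.PosStationary μ₀) (hg : IsGreedy g) (hθ : 2 ≤ 𝓜.rate μ₀ * θ) (hθ2 : 2 ≤ θ)
    (hθξ : θ ≤ ξ) (hQ₀ : ‖Q₀‖ ≤ 1) (hQL₀ : ‖QL₀‖ ≤ 1) (hQU₀ : ‖QU₀‖ ≤ 1) {l k : ℕ}
    (hε : ∀ x, ∑ y, |(𝓜.chain ^ l) x y - 𝓜.muInf μ₀ y| ≤ 2 * stepSize θ ξ k)
    (j : ℕ) (hj : j ≤ k) :
    ∫ ω, ‖𝓜.QUpper μ₀ g (stepSize θ ξ) Q₀ QU₀ (fun i => Z i ω) j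
        - 𝓜.QLower μ₀ g (stepSize θ ξ) Q₀ QL₀ (fun i => Z i ω) j‖ ∂ℙ
      ≤ (2 * √ξ + 4 * 𝓜.dMax μ₀ / 𝓜.rate μ₀ * (√ξ * ‖QL₀ - 𝓜.QStar‖
          + √(Fintype.card S * Fintype.card A
            * (42 * (l + 1) * 𝓜.noiseSumBound μ₀ ^ 2 * θ)))) / √(j + ξ) := by
  have hξ0 : 0 < ξ := by linarith
  have hα := stepSize_nonneg (θ := θ) (ξ := ξ) (by linarith) hξ0.le
  have hα' := stepSize_le_one hξ0 hθξ
  have hκ := hp.rate_pos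
  have hd := hp.dMax_nonneg
  set E := √ξ * ‖QL₀ - 𝓜.QStar‖ + √(Fintype.card S * Fintype.card A
    * (42 * (l + 1) * 𝓜.noiseSumBound μ₀ ^ 2 * θ)) with hE
  have hE0 : 0 ≤ E := by positivity
  induction j with
  | zero =>
    simp only [QUpper, QLower]
    rw [integral_const, probReal_univ, one_smul, Nat.cast_zero, zero_add,
      le_div_iff₀ (Real.sqrt_pos.2 hξ0)]
    have h1 : ‖QU₀ - QL₀‖ ≤ 2 := (norm_sub_le _ _).trans (by linarith)
    have h2 : 0 ≤ 4 * 𝓜.dMax μ₀ / 𝓜.rate μ₀ * E := by positivity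
    have h3 := mul_le_mul_of_nonneg_right h1 (Real.sqrt_nonneg ξ)
    linarith
  | succ j ih =>
    have hjk : j ≤ k := (Nat.le_succ j).trans hj
    have hj0 : (0 : ℝ) ≤ j := Nat.cast_nonneg j
    have hiD := hZ.integrable_gap (g := g) (Q₀ := Q₀) (QL₀ := QL₀) (QU₀ := QU₀) (stepSize θ ξ)
    have hiL : Integrable (fun ω => 2 * 𝓜.dMax μ₀ * ‖𝓜.QLower μ₀ g (stepSize θ ξ) Q₀ QL₀
        (fun i => Z i ω) j - 𝓜.QStar‖) ℙ := hZ.integrable_of_determinedBy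
      ((determinedBy_QLower 𝓜 μ₀ g (stepSize θ ξ) Q₀ QL₀ Z j).comp
        fun W => 2 * 𝓜.dMax μ₀ * ‖W - 𝓜.QStar‖)
    refine (integral_mono (hiD (j + 1)) (((hiD j).const_mul _).add (hiL.const_mul _))
      fun ω => hp.norm_gap_succ_le hα hα' _ j).trans ?_
    rw [integral_add' ((hiD j).const_mul _) (hiL.const_mul _), integral_const_mul,
      integral_const_mul, integral_const_mul]
    have h1 := mul_le_mul_of_nonneg_left (ih hjk)
      (sub_nonneg.2 (hp.rate_mul_le_one (hα j) (hα' j)))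
    have h2 := mul_le_mul_of_nonneg_left (mul_le_mul_of_nonneg_left
      (hZ.integral_norm_QLower_sub_le (QL₀ := QL₀) hμ₀ hp hg hθ hθ2 hθξ hQ₀ hε j hjk)
      (mul_nonneg zero_le_two hd)) (hα j)
    refine (add_le_add h1 h2).trans ?_
    -- The coefficient `4 d_max / κ` is what `2 b ≤ κ U` demands for the forcing `b = 2 d_max E`;
    -- the term `2 √ξ` pays for the initial gap.
    have h3 := sqrt_recursion_step (θ := θ) (t := j + ξ) (b := 2 * 𝓜.dMax μ₀ * E)
      (U := 2 * √ξ + 4 * 𝓜.dMax μ₀ / 𝓜.rate μ₀ * E) (by linarith) hθ (by positivity) (by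
        have h4 : 𝓜.rate μ₀ * (2 * √ξ + 4 * 𝓜.dMax μ₀ / 𝓜.rate μ₀ * E)
            = 2 * (𝓜.rate μ₀ * √ξ) + 4 * 𝓜.dMax μ₀ * E := by field_simp
        have h5 : 0 ≤ 𝓜.rate μ₀ * √ξ := by positivity
        rw [h4]
        linarith) (by linarith)
    push_cast
    rw [add_right_comm (j : ℝ) 1 ξ]
    refine le_trans (le_of_eq ?_) h3
    rw [stepSize, mul_div_assoc (2 * 𝓜.dMax μ₀)]

end IsTrajectory

end Model

/-! ### Comparison of constants and conclusion -/

/-- Comparison of the explicit constants, in terms of `h = n^{1/8}`, `p = √d_min`, `q = √(1 - γ)`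
and `v = √d_max`. -/
lemma constant_le {K h p q v s y X Y : ℝ} (hK : 1 ≤ K) (hh : 1 ≤ h) (hp : 0 < p) (hq : 0 < q)
    (hq' : q ≤ 1) (hv : 0 ≤ v) (hv' : v ≤ 1) (hhp : h ^ 8 * p ^ 2 ≤ 1) (hs : 0 ≤ s) (hy : 0 ≤ y)
    (hX : X ≤ 4 * K ^ 2 * (h ^ 32 * v ^ 3 / (q * p) ^ 3))
    (hY : Y ≤ 26 * K * (h ^ 8 * (s + 1) / (q ^ 2 * (q * p) ^ 3))) :
    2 * X + 4 * v ^ 2 / (q * p) ^ 2 * (X * y + Y)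
      ≤ 200 * K ^ 2 * max (h ^ 32 * v ^ 5 / (q ^ 5 * p ^ 5) * y) (h ^ 30 / (q ^ 8 * p ^ 6))
        + 200 * K ^ 2 * h ^ 31 * v ^ 2 / (q ^ 7 * p ^ 5) * s := by
  have hp1 : p ≤ 1 := by
    have h1 : p ^ 2 ≤ 1 := by
      have : 1 * p ^ 2 ≤ h ^ 8 * p ^ 2 := by gcongr; exact one_le_pow₀ hh
      linarith
    exact (sq_le_one_iff₀ hp.le).1 h1
  set F₁ := h ^ 32 * v ^ 5 / (q ^ 5 * p ^ 5) * y with hF₁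
  set F₂ := h ^ 30 / (q ^ 8 * p ^ 6) with hF₂
  have hF₁0 : 0 ≤ F₁ := by positivity
  have hF₂0 : 0 ≤ F₂ := by positivity
  -- The left side has an excess `h² = n^{1/4}`, paid for by `n d_min ≤ 1`.
  have a1 : h ^ 32 * v ^ 3 / (q * p) ^ 3 ≤ F₂ := by
    rw [hF₂, div_le_div_iff₀ (by positivity) (by positivity)]
    calc h ^ 32 * v ^ 3 * (q ^ 8 * p ^ 6)
        = h ^ 30 * (q * p) ^ 3 * (h ^ 2 * p ^ 2 * (p * v ^ 3 * q ^ 5)) := by ring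
      _ ≤ h ^ 30 * (q * p) ^ 3 * (1 * 1) := by
        gcongr
        · calc h ^ 2 * p ^ 2 ≤ h ^ 8 * p ^ 2 := by gcongr; norm_num
            _ ≤ 1 := hhp
        · exact mul_le_one₀ (mul_le_one₀ hp1 (by positivity) (pow_le_one₀ hv hv'))
            (by positivity) (pow_le_one₀ hq.le hq')
      _ = _ := by ring
  have a2 : h ^ 8 * v ^ 2 / (q ^ 7 * p ^ 5) ≤ F₂ := by
    rw [hF₂, div_le_div_iff₀ (by positivity) (by positivity)]
    calc h ^ 8 * v ^ 2 * (q ^ 8 * p ^ 6)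
        = h ^ 8 * (q ^ 7 * p ^ 5) * (v ^ 2 * (q * p)) := by ring
      _ ≤ h ^ 30 * (q ^ 7 * p ^ 5) * 1 := by
        gcongr
        · norm_num
        · exact mul_le_one₀ (pow_le_one₀ hv hv') (by positivity) (mul_le_one₀ hq' hp.le hp1)
      _ = _ := by ring
  have a3 : h ^ 8 * v ^ 2 / (q ^ 7 * p ^ 5) * s ≤ h ^ 31 * v ^ 2 / (q ^ 7 * p ^ 5) * s := by
    gcongr
    norm_num
  set G := h ^ 31 * v ^ 2 / (q ^ 7 * p ^ 5) * s with hG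
  have hG0 : 0 ≤ G := by positivity
  have b1 : 2 * X ≤ 8 * K ^ 2 * F₂ := by
    have := mul_le_mul_of_nonneg_left a1 (by positivity : 0 ≤ 4 * K ^ 2)
    linarith
  -- Here the monomials agree exactly: this term gives the coefficient of the initial error.
  have b2 : 4 * v ^ 2 / (q * p) ^ 2 * (X * y) ≤ 16 * K ^ 2 * F₁ := by
    calc _ ≤ 4 * v ^ 2 / (q * p) ^ 2 * (4 * K ^ 2 * (h ^ 32 * v ^ 3 / (q * p) ^ 3) * y) := by
          gcongr
      _ = _ := by rw [hF₁]; field_simp; ring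
  have b3 : 4 * v ^ 2 / (q * p) ^ 2 * Y ≤ 104 * K ^ 2 * (F₂ + G) := by
    calc _ ≤ 4 * v ^ 2 / (q * p) ^ 2
          * (26 * K * (h ^ 8 * (s + 1) / (q ^ 2 * (q * p) ^ 3))) := by gcongr
      _ = 104 * K * (h ^ 8 * v ^ 2 / (q ^ 7 * p ^ 5) + h ^ 8 * v ^ 2 / (q ^ 7 * p ^ 5) * s) := by
        field_simp
        ring
      _ ≤ 104 * K ^ 2 * (F₂ + G) := by
        gcongr
        exact le_self_pow₀ hK two_ne_zero
  have hm1 := mul_le_mul_of_nonneg_left (le_max_left F₁ F₂) (by positivity : 0 ≤ 16 * K ^ 2)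
  have hm2 := mul_le_mul_of_nonneg_left (le_max_right F₁ F₂) (by positivity : 0 ≤ 112 * K ^ 2)
  have hm3 : 0 ≤ K ^ 2 * max F₁ F₂ := mul_nonneg (by positivity) (hF₁0.trans (le_max_left _ _))
  have hm4 : 0 ≤ K ^ 2 * G := by positivity
  have e : 200 * K ^ 2 * h ^ 31 * v ^ 2 / (q ^ 7 * p ^ 5) * s = 200 * K ^ 2 * G := by
    rw [hG]; ring
  rw [e, mul_add]
  linarith

lemma rpow_div_two_eq_sqrt_pow {x : ℝ} (hx : 0 ≤ x) (k : ℕ) : x ^ ((k : ℝ) / 2) = √x ^ k := by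
  rw [Real.sqrt_eq_rpow, ← Real.rpow_natCast, ← Real.rpow_mul hx]
  congr 1
  ring

lemma rpow_div_eight_eq_pow {x : ℝ} (hx : 0 ≤ x) (k : ℕ) :
    x ^ ((k : ℝ) / 8) = (x ^ (1 / 8 : ℝ)) ^ k := by
  rw [← Real.rpow_natCast, ← Real.rpow_mul hx]
  congr 1
  ring

end QLearning

theorem mainTheorem2 (c : ℝ) :
    ∃ C : ℝ, 0 < C ∧
      ∀ (S : Type u) (A : Type v) [Fintype S] [Fintype A] [DecidableEq S] [DecidableEq A]
        [Nonempty S] [Nonempty A] (𝓜 : QLearning.Model S A)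
        -- the Markovian observation model
        (μ₀ : S × A → ℝ) (hμ₀ : ∀ x, 0 ≤ μ₀ x) (hμ₀' : ∑ x, μ₀ x = 1)
        (hirr : 𝓜.chain.IsIrreducible) (haper : QLearning.Aperiodic 𝓜.chain)
        (m ρ : ℝ) (hm : 0 < m) (hρ : 0 < ρ) (hρ' : ρ < 1) (hmix : 𝓜.MixesWith μ₀ m ρ)
        (Ω : Type w) [MeasurableSpace Ω] (ℙ : MeasureTheory.Measure Ω)
        [MeasureTheory.IsProbabilityMeasure ℙ]
        (Z : ℕ → Ω → S × A) (hZ : 𝓜.IsTrajectory μ₀ ℙ Z)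
        -- the greedy selector, the step-size and the initial values
        (g : (S × A → ℝ) → S → A) (hg : QLearning.IsGreedy g)
        (θ ξ : ℝ) (hstep : 𝓜.IsStepParam μ₀ g c θ ξ)
        (Q₀ QL₀ QU₀ : S × A → ℝ) (hQ₀ : ‖Q₀‖ ≤ 1) (hQL₀ : ‖QL₀‖ ≤ 1) (hQU₀ : ‖QU₀‖ ≤ 1)
        (hL : QL₀ ≤ Q₀) (hU : Q₀ ≤ QU₀)
        (k : ℕ), QLearning.KMix m ρ (QLearning.stepSize θ ξ) ≤ k →
        let α := QLearning.stepSize θ ξ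
        let n : ℝ := (Fintype.card S : ℝ) * (Fintype.card A : ℝ)
        let dmin := 𝓜.dMin μ₀
        let dmax := 𝓜.dMax μ₀
        let CU : ℝ := C * max
          (n ^ (4 : ℝ) * dmax ^ (5 / 2 : ℝ) / ((1 - 𝓜.γ) ^ (5 / 2 : ℝ) * dmin ^ (5 / 2 : ℝ))
            * QLearning.norm2 (QL₀ - 𝓜.QStar))
          (n ^ (15 / 4 : ℝ) / ((1 - 𝓜.γ) ^ (4 : ℝ) * dmin ^ (3 : ℝ)))
        let gap : Ω → ℝ := fun ω =>
          ‖𝓜.QUpper μ₀ g α Q₀ QU₀ (fun i => Z i ω) k - 𝓜.QLower μ₀ g α Q₀ QL₀ (fun i => Z i ω) k‖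
        MeasureTheory.Integrable gap ℙ ∧
        ∫ ω, gap ω ∂ℙ ≤
          CU / √((k : ℝ) + ξ)
          + C * n ^ (31 / 8 : ℝ) * dmax / ((1 - 𝓜.γ) ^ (7 / 2 : ℝ) * dmin ^ (5 / 2 : ℝ))
            * (√(QLearning.tauMix m ρ (α k) : ℝ) / √((k : ℝ) + ξ)) := by
  have hc : 0 ≤ max c 0 := le_max_right _ _
  refine ⟨200 * (1 + max c 0) ^ 2, by positivity, ?_⟩
  intro S A _ _ _ _ _ _ 𝓜 μ₀ hμ₀ _ hirr _ m ρ _ hρ hρ' hmix Ω _ ℙ _ Z hZ g hg θ ξ hstep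
    Q₀ QL₀ QU₀ hQ₀ hQL₀ hQU₀ _ _ k _ α n dmin dmax CU gap
  have hp : 𝓜.PosStationary μ₀ := ⟨hmix.muInf_pos hρ hρ' hirr, hmix.muInf_sum hρ hρ'⟩
  refine ⟨hZ.integrable_gap α k, ?_⟩
  have hθ := hstep.two_le_rate_mul hp
  have hθ2 := hstep.two_le hp
  have hθξ := hstep.ξ_lower
  have hξ0 : 0 < ξ := by linarith
  -- The single lag `τ^mix(α_k)` serves every time `j ≤ k`, since `α_k ≤ α_j`. The factor two passes
  -- from total variation to `ℓ¹`.
  have hε : ∀ x, ∑ y, |(𝓜.chain ^ QLearning.tauMix m ρ (α k)) x y - 𝓜.muInf μ₀ y|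
      ≤ 2 * QLearning.stepSize θ ξ k := fun x =>
    (hmix.sum_abs_le x _).trans (mul_le_mul_of_nonneg_left (QLearning.mul_pow_tauMix_le hρ.le hρ'
      (QLearning.stepSize_pos (by linarith) hξ0 k)) zero_le_two)
  refine (hZ.integral_norm_gap_le hμ₀ hp hg hθ hθ2 hθξ hQ₀ hQL₀ hQU₀ hε k le_rfl).trans ?_
  rw [← mul_div_assoc, ← add_div]
  refine div_le_div_of_nonneg_right ?_ (Real.sqrt_nonneg _)
  have hγ : 0 < 1 - 𝓜.γ := sub_pos.2 𝓜.γ_lt_one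
  have hγ1 : 1 - 𝓜.γ ≤ 1 := by linarith [𝓜.γ_nonneg]
  have hn : 1 ≤ n := QLearning.Model.one_le_card
  have hn0 : 0 ≤ n := zero_le_one.trans hn
  have hdmin : 0 < dmin := hp.dMin_pos
  have hdmax : 0 ≤ dmax := hp.dMax_nonneg
  have hθ' := hstep.theta_le hp
  have hξ' := hstep.xi_le hp
  have hy := QLearning.norm_le_norm2 (QL₀ - 𝓜.QStar)
  have hy0 := QLearning.norm2_nonneg (QL₀ - 𝓜.QStar)
  set l := QLearning.tauMix m ρ (α k)
  set y := QLearning.norm2 (QL₀ - 𝓜.QStar)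
  set K := 1 + max c 0 with hK
  have hK1 : 1 ≤ K := by linarith
  have hl : (0 : ℝ) ≤ l := Nat.cast_nonneg l
  -- With these roots every real exponent in the statement becomes a natural one.
  set h := n ^ (1 / 8 : ℝ) with hh
  set p := √dmin with hpdef
  set q := √(1 - 𝓜.γ) with hqdef
  set v := √dmax with hvdef
  have en : n = h ^ 8 := by
    rw [hh, ← QLearning.rpow_div_eight_eq_pow hn0 8]
    norm_num
  have ep : p ^ 2 = dmin := Real.sq_sqrt hdmin.le
  have eq : q ^ 2 = 1 - 𝓜.γ := Real.sq_sqrt hγ.le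
  have ev : v ^ 2 = dmax := Real.sq_sqrt hdmax
  have hp0 : 0 < p := Real.sqrt_pos.2 hdmin
  have hq0 : 0 < q := Real.sqrt_pos.2 hγ
  have hv0 : 0 ≤ v := Real.sqrt_nonneg _
  have hh1 : 1 ≤ h := Real.one_le_rpow hn (by norm_num)
  have hs0 : 0 ≤ √(l : ℝ) := Real.sqrt_nonneg _
  have hs2 : √(l : ℝ) ^ 2 = l := Real.sq_sqrt hl
  have erate : 𝓜.rate μ₀ = (q * p) ^ 2 := by rw [mul_pow, eq, ep]; rfl
  have eB : 𝓜.noiseSumBound μ₀ = 4 / (q ^ 2 * (q * p) ^ 2) := by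
    rw [QLearning.Model.noiseSumBound, QLearning.Model.horizon, erate, ← eq]
    field_simp
  have hX : √ξ ≤ 4 * K ^ 2 * (h ^ 32 * v ^ 3 / (q * p) ^ 3) := by
    refine Real.sqrt_le_iff.2 ⟨by positivity, hξ'.trans_eq ?_⟩
    change 16 * K ^ 4 * (n ^ 8 * dmax ^ 3 / 𝓜.rate μ₀ ^ 3) = _
    rw [erate, en, ← ev]
    ring
  have hY : √(n * (42 * ((l : ℝ) + 1) * 𝓜.noiseSumBound μ₀ ^ 2 * θ))
      ≤ 26 * K * (h ^ 8 * (√(l : ℝ) + 1) / (q ^ 2 * (q * p) ^ 3)) := by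
    refine Real.sqrt_le_iff.2 ⟨by positivity, ?_⟩
    have hθ'' : θ ≤ K * (n / 𝓜.rate μ₀) := by
      refine hθ'.trans (mul_le_mul_of_nonneg_right (by linarith) ?_)
      rw [erate]
      positivity
    have hls : (l : ℝ) + 1 ≤ (√(l : ℝ) + 1) ^ 2 := by linarith [add_sq (√(l : ℝ)) 1]
    rw [erate, en] at hθ''
    rw [eB, en]
    calc h ^ 8 * (42 * ((l : ℝ) + 1) * (4 / (q ^ 2 * (q * p) ^ 2)) ^ 2 * θ)
        ≤ h ^ 8 * (42 * (√(l : ℝ) + 1) ^ 2 * (4 / (q ^ 2 * (q * p) ^ 2)) ^ 2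
          * (K * (h ^ 8 / (q * p) ^ 2))) := by gcongr
      -- `672 = 42 · 4²`, rounded up to the square `676 = 26²` so that the root can be taken.
      _ = 672 * K * (h ^ 8 * (√(l : ℝ) + 1) / (q ^ 2 * (q * p) ^ 3)) ^ 2 := by
        field_simp
        norm_num
      _ ≤ 676 * K ^ 2 * (h ^ 8 * (√(l : ℝ) + 1) / (q ^ 2 * (q * p) ^ 3)) ^ 2 := by
        refine mul_le_mul_of_nonneg_right ?_ (sq_nonneg _)
        nlinarith
      _ = _ := by ring
  have key := QLearning.constant_le hK1 hh1 hp0 hq0 (Real.sqrt_le_one.2 hγ1) hv0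
    (Real.sqrt_le_one.2 hp.dMax_le_one) (by rw [ep, ← en]; exact hp.card_mul_dMin_le) hs0 hy0 hX hY
  have r1 : n ^ (4 : ℝ) = h ^ 32 := by
    rw [← QLearning.rpow_div_eight_eq_pow hn0]; norm_num
  have r2 : n ^ (15 / 4 : ℝ) = h ^ 30 := by
    rw [← QLearning.rpow_div_eight_eq_pow hn0]; norm_num
  have r3 : n ^ (31 / 8 : ℝ) = h ^ 31 := by
    rw [← QLearning.rpow_div_eight_eq_pow hn0]; norm_num
  have r4 : dmax ^ (5 / 2 : ℝ) = v ^ 5 := by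
    rw [← QLearning.rpow_div_two_eq_sqrt_pow hdmax]; norm_num
  have r5 : dmin ^ (5 / 2 : ℝ) = p ^ 5 := by
    rw [← QLearning.rpow_div_two_eq_sqrt_pow hdmin.le]; norm_num
  have r6 : dmin ^ (3 : ℝ) = p ^ 6 := by
    rw [← QLearning.rpow_div_two_eq_sqrt_pow hdmin.le]; norm_num
  have r7 : (1 - 𝓜.γ) ^ (5 / 2 : ℝ) = q ^ 5 := by
    rw [← QLearning.rpow_div_two_eq_sqrt_pow hγ.le]; norm_num
  have r8 : (1 - 𝓜.γ) ^ (7 / 2 : ℝ) = q ^ 7 := by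
    rw [← QLearning.rpow_div_two_eq_sqrt_pow hγ.le]; norm_num
  have r9 : (1 - 𝓜.γ) ^ (4 : ℝ) = q ^ 8 := by
    rw [← QLearning.rpow_div_two_eq_sqrt_pow hγ.le]; norm_num
  simp only [CU]
  rw [r1, r2, r3, r4, r5, r6, r7, r8, r9]
  rw [erate, show 𝓜.dMax μ₀ = v ^ 2 from ev.symm]
  have hmono : √ξ * ‖QL₀ - 𝓜.QStar‖ ≤ √ξ * y := by gcongr
  rw [← ev]
  refine le_trans ?_ key
  gcongr
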